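/- Consider a single-user decode-and-forward relay network with $L\ge 2$ hops and $M\ge 1$ relay nodes per hop, in which the source and the destination are regarded as node $1$ of layer $0$ and of layer $L$. The SNR of a link with channel coefficient $h$ is $\frac{P}{\sigma^2}|h|^2$, where $P>0$ is the transmit power, $\sigma^2>0$ is the noise variance, and $h$ is a Rayleigh fading coefficient, i.e. circularly symmetric complex Gaussian with mean zero and variance $\sigma_1^2>0$. Put $\sigma_a^2=P\sigma_1^2/\sigma^2$. *Sliding-window selection with $w=2$.* There are $T=L-w+1=L-1$ windows, window $t$ consisting of the hops $t$ and $t+1$. Put $r(0)=r(L)=1$. For $t=1,\dots,T-1$, a path $r(t-1)\to k\to j$ that maximizes the achievable rate (equivalently, the minimum of the two link SNRs) in window $t$ over all $k,j\in\{1,\dots,M\}$ is found, and $r(t)=k$ is fixed; in the last window, $r(T)=k$ maximizes the rate of $r(T-1)\to k\to 1$. Ties are broken in any way. In the *independent window model* each window has its own copies of the channel coefficients of its two hops, and all coefficients, within a window and across windows, are independent. The SNR of hop $t\le T$ is that of the link from $r(t-1)$ to $r(t)$ in the first hop of window $t$, the SNR of hop $L$ is that of the link from $r(T)$ to the destination in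 the second hop of window $T$, and the end-to-end SNR $\gamma^{\min}$ is the minimum of these $L$ SNRs. The achievable rate is $R^{\mathrm{sliding}}_{\mathrm{ind}}=\mathbb E[\log_2(1+\gamma^{\min})]$. For $s>0$ and $x\ge 0$ let $$S_{M,s}(x)=1-(1-e^{-x/s})^M-\sum_{N=1}^{M-1}P^M_N\,e^{-(M-N)x/s}\int_{g_1=0}^{x}\tfrac1s e^{-g_1/s}\int_{g_2=g_1}^{x}\tfrac1s e^{-g_2/s}\cdots\int_{g_N=g_{N-1}}^{x}\tfrac1s e^{-g_N/s}\,p_N(g_1,\dots,g_N)\,dg_N\cdots dg_1,$$ $$p_N(g_1,\dots,g_N)=\sum_{k=1}^{N}(M-N)\left(\frac{(1-e^{-g_k/s})^{M(M-k)}}{M-k}-\frac{(1-e^{-g_k/s})^{M(M-k+1)}}{M-k+1}\right),\qquad P^M_N=\frac{M!}{(M-N)!}.$$ Then, in the independent window model: 1. The CDF of $\gamma^{\min}$ vanishes for $x<0$, and for $x\ge0$ it is $$F_{\gamma^{\min}}(x)=1-\Bigl(1-\bigl(1-e^{-2x/\sigma_a^2}\bigr)^M\Bigr)\,S_{M,\sigma_a^2}(x)^{T-1}.$$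 2. If $M\ge2$ and $\bar Q=M^2(M^2-1)$, there are real numbers $a_1,\dots,a_{\bar Q}$ and positive real numbers $b_1,\dots,b_{\bar Q}$, depending only on $M$, such that $\sum_{q=1}^{\bar Q}a_q e^{-b_qx/s}=S_{M,s}(x)$ for all $s>0$ and $x\ge0$. 3. Let $Q$ be a natural number (for instance $Q=\bar Q$), and let $a_1,\dots,a_Q$ be real and $b_1,\dots,b_Q\ge0$ with $\sum_{q=1}^{Q}a_q e^{-b_qx/\sigma_a^2}=S_{M,\sigma_a^2}(x)$ for all $x\ge0$. Then $\log_2(1+\gamma^{\min})$ is integrable and $$R^{\mathrm{sliding}}_{\mathrm{ind}}=\frac1{\log 2}\sum_{i=1}^{M}\ \sum_{l_1+\dots+l_Q=T-1}A_{l_1\dots l_Q}(i)\;e^{\beta_{l_1\dots l_Q}(i)/\sigma_a^2}\,Ei\!\left(-\frac{\beta_{l_1\dots l_Q}(i)}{\sigma_a^2}\right),$$ where the inner sum is over non-negative integers $l_1,\dots,l_Q$, and $$A_{l_1\dots l_Q}(i)=\binom Mi\binom{T-1}{l_1,\dots,l_Q}\Bigl(\prod_{q=1}^{Q}a_q^{l_q}\Bigr)(-1)^i,\qquad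 \beta_{l_1\dots l_Q}(i)=2i+\sum_{q=1}^{Q}b_ql_q,\qquad Ei(-y)=-\int_y^\infty\frac{e^{-t}}t\,dt\quad(y>0).$$ -/

import Mathlib

open MeasureTheory ProbabilityTheory

noncomputable section

namespace SlidingRelay

/-- Circularly symmetric complex Gaussian law of mean zero and variance `v`: the real and the
imaginary part are independent centred real Gaussians of variance `v / 2` each.  Its modulus is
Rayleigh distributed. -/
def rayleighFading (v : ℝ) : Measure ℂ :=
  ((gaussianReal 0 (v / 2).toNNReal).prod (gaussianReal 0 (v / 2).toNNReal)).map
    (fun p : ℝ × ℝ => (⟨p.1, p.2⟩ : ℂ))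

/-- The exponential integral on the negative half-line, `Ei(x) = -∫_{-x}^∞ e^{-t} / t dt`
for `x < 0` (it is only ever evaluated there). -/
def Ei (x : ℝ) : ℝ := -∫ t in Set.Ioi (-x), Real.exp (-t) / t

section Network

variable {Ω : Type*}

/-- The channel coefficients seen by the windows.  `h t 0 i j` and `h t 1 i j` are the coefficients,
from node `i` to node `j`, of the first and of the second hop of window `t` (`t = 1, 2, …`);
window `t` consists of the hops `t` and `t + 1` of the network. -/
abbrev WindowChannels (Ω : Type*) (M : ℕ) := ℕ → Fin 2 → Fin M → Fin M → Ω → ℂ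

/-- Independent window model with `T` windows: every coefficient of every window is a Rayleigh
fading coefficient of mean zero and variance `v`, and all of them, within a window and across
windows, are independent. -/
structure IsIndependentWindowModel [MeasurableSpace Ω] {M : ℕ} (μ : Measure Ω) (T : ℕ) (v : ℝ)
    (h : WindowChannels Ω M) : Prop where
  measurable : ∀ t ∈ Finset.Icc 1 T, ∀ s i j, Measurable (h t s i j)
  law : ∀ t ∈ Finset.Icc 1 T, ∀ s i j, μ.map (h t s i j) = rayleighFading v
  indep : iIndepFun
    (fun (q : Finset.Icc 1 T × Fin 2 × Fin M × Fin M) => h q.1 q.2.1 q.2.2.1 q.2.2.2) μ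

/-- Received SNR `P |h|² / σ²` of a link, `noise` being the noise variance `σ²`. -/
def snr {M : ℕ} (P noise : ℝ) (h : WindowChannels Ω M) (t : ℕ) (s : Fin 2) (i j : Fin M)
    (ω : Ω) : ℝ :=
  P / noise * ‖h t s i j ω‖ ^ 2

/-- Achievable rate in the two hops of window `t` along the path `i → k → j`. -/
def windowRate {M : ℕ} (P noise : ℝ) (h : WindowChannels Ω M) (t : ℕ) (i k j : Fin M)
    (ω : Ω) : ℝ :=
  Real.logb 2 (1 + min (snr P noise h t 0 i k ω) (snr P noise h t 1 k j ω))

/-- `r l` is the relay selected at hop `l` by the sliding window strategy with window size two and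
`T` windows, hence `T + 1` hops.  Source and destination are the node with index `0` of layer `0`
and of layer `T + 1`.  In each window but the last, a two-hop path of maximal rate that starts at
the node selected before (and may end at any node) is found and only its first relay is fixed; in
the last window the path has to end at the destination. Ties may be broken in any way. -/
structure IsSlidingSelection {M : ℕ} [NeZero M] (T : ℕ) (P noise : ℝ) (h : WindowChannels Ω M)
    (r : ℕ → Ω → Fin M) : Prop where
  source : ∀ ω, r 0 ω = 0
  destination : ∀ ω, r (T + 1) ω = 0
  window : ∀ t, 1 ≤ t → t < T → ∀ ω, ∃ j, ∀ k' j',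
    windowRate P noise h t (r (t - 1) ω) k' j' ω ≤ windowRate P noise h t (r (t - 1) ω) (r t ω) j ω
  last : ∀ ω, ∀ k',
    windowRate P noise h T (r (T - 1) ω) k' 0 ω ≤ windowRate P noise h T (r (T - 1) ω) (r T ω) 0 ω

/-- SNR of the selected link in hop `l`, for `1 ≤ l ≤ T + 1`: the first hop of window `l` for
`l ≤ T`, the second hop of the last window for `l = T + 1`. -/
def hopSNR {M : ℕ} (T : ℕ) (P noise : ℝ) (h : WindowChannels Ω M) (r : ℕ → Ω → Fin M) (l : ℕ)
    (ω : Ω) : ℝ :=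
  if l ≤ T then snr P noise h l 0 (r (l - 1) ω) (r l ω) ω
  else snr P noise h T 1 (r (l - 1) ω) (r l ω) ω

/-- End-to-end SNR: the minimum of the SNRs of the hops `1, …, T + 1`. -/
def endToEndSNR {M : ℕ} (T : ℕ) (P noise : ℝ) (h : WindowChannels Ω M) (r : ℕ → Ω → Fin M)
    (ω : Ω) : ℝ :=
  ⨅ l : Fin (T + 1), hopSNR T P noise h r (l + 1) ω

end Network

/-- The probability that one of the `N` weakest first-hop links is selected, given the values
`g 0 < … < g (N - 1)` of their SNRs; `s` is the mean SNR.  The summand of index `k : Fin N` is the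
`(k + 1)`-st one when counting from one. -/
def selectionProb (M N : ℕ) (s : ℝ) (g : Fin N → ℝ) : ℝ :=
  ∑ k : Fin N, ((M : ℝ) - N) *
    ((1 - Real.exp (-g k / s)) ^ (M * (M - (k + 1))) / ((M : ℝ) - (k + 1))
      - (1 - Real.exp (-g k / s)) ^ (M * (M - (k + 1) + 1)) / ((M : ℝ) - (k + 1) + 1))

/-- `∫_{g₁ = lo}^x ρ(g₁) ∫_{g₂ = g₁}^x ρ(g₂) ⋯ ∫_{g_N = g_{N-1}}^x ρ(g_N) f(g₁, …, g_N)`. -/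
def nestedIntegral (ρ : ℝ → ℝ) (x : ℝ) : (N : ℕ) → ℝ → ((Fin N → ℝ) → ℝ) → ℝ
  | 0, _, f => f Fin.elim0
  | N + 1, lo, f => ∫ g in lo..x, ρ g * nestedIntegral ρ x N g (fun v => f (Fin.cons g v))

/-- The function
`1 - (1 - e^{-x/s})^M - ∑_{N=1}^{M-1} P^M_N e^{-(M-N)x/s} ∫⋯∫ selectionProb ∏ (1/s) e^{-g_i/s} dg`
of the mean SNR `s`, where `P^M_N = M! / (M-N)!`. -/
def windowTail (M : ℕ) (s x : ℝ) : ℝ :=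
  1 - (1 - Real.exp (-x / s)) ^ M
    - ∑ N ∈ Finset.Icc 1 (M - 1), (M.descFactorial N : ℝ) * Real.exp (-((M : ℝ) - N) * x / s) *
        nestedIntegral (fun g => 1 / s * Real.exp (-g / s)) x N 0 (selectionProb M N s)

/-- `A^n_{l₁…l_Q}(i) = C(M,i) (n; l₁,…,l_Q) (∏ a_q^{l_q}) (-1)^i`, where `n = ∑ l_q`. -/
def coeffA (M : ℕ) {Q : ℕ} (a : Fin Q → ℝ) (i : ℕ) (l : Fin Q → ℕ) : ℝ :=
  (M.choose i : ℝ) * (Nat.multinomial Finset.univ l : ℝ) * (∏ q, a q ^ l q) * (-1) ^ i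

/-- `β_{l₁…l_Q}(i) = 2 i + ∑ b_q l_q`. -/
def coeffBeta {Q : ℕ} (b : Fin Q → ℝ) (i : ℕ) (l : Fin Q → ℕ) : ℝ :=
  2 * (i : ℝ) + ∑ q, b q * (l q : ℝ)

end SlidingRelay

end

/-! Fix a window and its starting node. Let `X k` be the SNR of the link to relay `k`, exponential
of mean `s`, and `V k` the best SNR out of `k`, a maximum of `M` such exponentials. All of these are
independent, and ties have probability zero. The chosen relay maximizes `min (X k) (V k)`. Its first
hop exceeds `x` in two disjoint cases: some path exceeds `x`, or none does and the chosen `k`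
satisfies `V k ≤ x < X k` with `V k` beating every other path. Conditioning on `V k` gives the
probability `1 - Φ(x)^M + M e^{-x/s} ∫_0^x f Φ^{M-1}`, where `Φ` is `pathCDF` and `f` is `maxPDF`
(`sum_measure_selectedAbove`).

The nested integrals in `windowTail` have integrands that are sums of functions of one variable
each. Cauchy's formula collapses them to single integrals (`nestedIntegral_const_add_sum`), binomial
identities sum these over the number of weak links (`mul_sum_selection`), and an explicit
antiderivative (`integral_selection`) leads to the same closed form, `windowTail_eq`. In the
variable `e^{-x/s}` it is a polynomial without constant term, hence the exponential sum of the
second claim.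

The window probability is the same for every starting node, and a window is independent of the
earlier ones, so the factors multiply (`sum_measure_survival`). The last window contributes the tail
of a maximum of `M` minima of two exponentials. The selection `r` need not be measurable: the events
`survival` are built from the channels alone and describe the true selection off the null set of
ties.

For the rate, the layer-cake formula gives `E log(1 + γ) = ∫_0^∞ P(γ > t) / (1 + t) dt`. The
binomial and multinomial theorems expand the tail into exponentials, each of which integrates to a
value of `Ei`. -/

namespace SlidingRelay

/-! ### Nested integrals and repeated integration -/

section NestedIntegral

/-- Iterated tail integrals `∫_g^x ρ ∫ ⋯ ∫ ρ ∫ ψ` with `k` factors `ρ`. -/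
noncomputable def iterTail (ρ : ℝ → ℝ) (x : ℝ) (ψ : ℝ → ℝ) : ℕ → ℝ → ℝ
  | 0 => fun g => ∫ y in g..x, ψ y
  | k + 1 => fun g => ∫ y in g..x, ρ y * iterTail ρ x ψ k y

theorem hasDerivAt_integral_left {f : ℝ → ℝ} (hf : Continuous f) (x g : ℝ) :
    HasDerivAt (fun g => ∫ y in g..x, f y) (-f g) g :=
  intervalIntegral.integral_hasDerivAt_left (hf.intervalIntegrable _ _)
    (hf.stronglyMeasurableAtFilter _ _) hf.continuousAt

theorem continuous_iterTail {ρ ψ : ℝ → ℝ} (hρ : Continuous ρ) (hψ : Continuous ψ) (x : ℝ) (k : ℕ) :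
    Continuous (iterTail ρ x ψ k) := by
  induction k with
  | zero => exact continuous_iff_continuousAt.2 fun g =>
    (hasDerivAt_integral_left hψ x g).continuousAt
  | succ k ih =>
    exact continuous_iff_continuousAt.2 fun g =>
      (hasDerivAt_integral_left (hρ.mul ih) x g).continuousAt

theorem iterTail_self (ρ : ℝ → ℝ) (x : ℝ) (ψ : ℝ → ℝ) (k : ℕ) : iterTail ρ x ψ k x = 0 := by
  cases k <;> simp [iterTail]

theorem hasDerivAt_pow_div_factorial {ρ R : ℝ → ℝ} (hR : ∀ g, HasDerivAt R (ρ g) g) (a : ℝ) (j : ℕ)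
    (g : ℝ) : HasDerivAt (fun g => (R g - a) ^ (j + 1) / (j + 1).factorial)
      (ρ g * ((R g - a) ^ j / j.factorial)) g := by
  have h := (((hR g).sub_const a).pow (j + 1)).div_const ((j + 1).factorial : ℝ)
  convert! h using 1
  have : ((j + 1).factorial : ℝ) = (j + 1) * j.factorial := by
    rw [Nat.factorial_succ]; push_cast; ring
  have h1 : (j.factorial : ℝ) ≠ 0 := by positivity
  rw [this]
  push_cast
  field_simp

/-- Integration by parts trades one layer of `iterTail` for one more power of `R - R lo`. Both
boundary terms vanish: the tail at `x`, the power at `lo`. The exponent `j` is free so that the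
induction on `k` can raise it. -/
theorem integral_pow_mul_iterTail {ρ R ψ : ℝ → ℝ} (hρ : Continuous ρ) (hψ : Continuous ψ)
    (hR : ∀ g, HasDerivAt R (ρ g) g) (x lo : ℝ) (k : ℕ) : ∀ j : ℕ,
    ∫ g in lo..x, (ρ g * ((R g - R lo) ^ j / j.factorial)) * iterTail ρ x ψ k g =
      ∫ y in lo..x, ψ y * ((R y - R lo) ^ (k + j + 1) / (k + j + 1).factorial) := by
  have hRc : Continuous R := continuous_iff_continuousAt.2 fun g => (hR g).continuousAt
  have key : ∀ (k j : ℕ) (w : ℝ → ℝ), Continuous w →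
      (∀ g, HasDerivAt (iterTail ρ x ψ k) (-w g) g) →
      ∫ g in lo..x, (ρ g * ((R g - R lo) ^ j / j.factorial)) * iterTail ρ x ψ k g =
        ∫ g in lo..x, (R g - R lo) ^ (j + 1) / (j + 1).factorial * w g := by
    intro k j w hw hd
    have h := intervalIntegral.integral_mul_deriv_eq_deriv_mul (a := lo) (b := x)
      (u := fun g => (R g - R lo) ^ (j + 1) / (j + 1).factorial) (v := iterTail ρ x ψ k)
      (u' := fun g => ρ g * ((R g - R lo) ^ j / j.factorial)) (v' := fun g => -w g)
      (fun g _ => hasDerivAt_pow_div_factorial hR (R lo) j g) (fun g _ => hd g)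
      (Continuous.intervalIntegrable (by fun_prop) _ _)
      (Continuous.intervalIntegrable (by fun_prop) _ _)
    simp only [iterTail_self, sub_self, mul_neg, intervalIntegral.integral_neg] at h
    simp only [ne_eq, Nat.add_eq_zero_iff, one_ne_zero, and_false, not_false_eq_true, zero_pow,
      zero_div, zero_mul, mul_zero, sub_self, zero_sub, neg_inj] at h
    exact h.symm
  induction k with
  | zero =>
    intro j
    rw [key 0 j ψ hψ fun g => hasDerivAt_integral_left hψ x g]
    simp only [zero_add]
    exact intervalIntegral.integral_congr fun g _ => mul_comm _ _
  | succ k ih =>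
    intro j
    rw [key (k + 1) j (fun g => ρ g * iterTail ρ x ψ k g)
      (hρ.mul (continuous_iterTail hρ hψ x k)) fun g =>
        hasDerivAt_integral_left (hρ.mul (continuous_iterTail hρ hψ x k)) x g]
    have := ih (j + 1)
    rw [show k + 1 + j + 1 = k + (j + 1) + 1 by ring, ← this]
    exact intervalIntegral.integral_congr fun g _ => by ring

/-- Cauchy's formula for repeated integration. -/
theorem iterTail_eq {ρ R ψ : ℝ → ℝ} (hρ : Continuous ρ) (hψ : Continuous ψ)
    (hR : ∀ g, HasDerivAt R (ρ g) g) (x lo : ℝ) (k : ℕ) :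
    iterTail ρ x ψ k lo = ∫ y in lo..x, ψ y * ((R y - R lo) ^ k / k.factorial) := by
  cases k with
  | zero => simp [iterTail]
  | succ k =>
    have := integral_pow_mul_iterTail hρ hψ hR x lo k 0
    simpa [iterTail] using this

/-- When only the variable of index `k` carries a nontrivial factor, the `k` variables below it and
the `N - 1 - k` above it range over ordered simplices, whose `ρ`-volumes are powers of increments of
`R` over factorials. -/
theorem nestedIntegral_const_add_sum {ρ R : ℝ → ℝ} (hρ : Continuous ρ)
    (hR : ∀ g, HasDerivAt R (ρ g) g) (x : ℝ) (N : ℕ) : ∀ (φ : Fin N → ℝ → ℝ)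
    (_ : ∀ k, Continuous (φ k)) (c lo : ℝ),
    nestedIntegral ρ x N lo (fun g => c + ∑ k, φ k (g k)) =
      c * ((R x - R lo) ^ N / N.factorial) +
      ∑ k : Fin N, ∫ y in lo..x, (ρ y * φ k y *
        ((R x - R y) ^ (N - 1 - k) / (N - 1 - k).factorial)) *
          ((R y - R lo) ^ (k : ℕ) / (k : ℕ).factorial) := by
  have hRc : Continuous R := continuous_iff_continuousAt.2 fun g => (hR g).continuousAt
  induction N with
  | zero => intro φ _ c lo; simp [nestedIntegral]
  | succ N ih =>
    intro φ hφ c lo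
    have e1 : ∀ g, nestedIntegral ρ x N g
        (fun v => c + ∑ k : Fin (N + 1), φ k ((Fin.cons g v : Fin (N + 1) → ℝ) k)) =
        (c + φ 0 g) * ((R x - R g) ^ N / N.factorial) +
        ∑ k : Fin N, iterTail ρ x (fun y => ρ y * φ k.succ y *
          ((R x - R y) ^ (N - 1 - k) / (N - 1 - k).factorial)) k g := by
      intro g
      -- For the inner integral `φ 0 g` is a constant; this is why the statement carries `c`.
      have := ih (fun k => φ k.succ) (fun k => hφ _) (c + φ 0 g) g
      simp only [Fin.sum_univ_succ, Fin.cons_zero, Fin.cons_succ, ← add_assoc]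
      rw [this]
      congr 1
      refine Finset.sum_congr rfl fun k _ => ?_
      rw [iterTail_eq hρ _ hR]
      have := hφ k.succ
      fun_prop
    have hcont : ∀ k : Fin N, Continuous (fun y => ρ y * φ k.succ y *
          ((R x - R y) ^ (N - 1 - k) / (N - 1 - k).factorial)) := by
      intro k
      have := hφ k.succ
      fun_prop
    have hφ0 := hφ 0
    rw [nestedIntegral]
    simp only [e1]
    have e2 : ∀ g, ρ g * ((c + φ 0 g) * ((R x - R g) ^ N / N.factorial) +
        ∑ k : Fin N, iterTail ρ x (fun y => ρ y * φ k.succ y *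
          ((R x - R y) ^ (N - 1 - k) / (N - 1 - k).factorial)) k g) =
        c * (ρ g * ((R x - R g) ^ N / N.factorial)) +
        (ρ g * φ 0 g * ((R x - R g) ^ N / N.factorial) +
        ∑ k : Fin N, ρ g * iterTail ρ x (fun y => ρ y * φ k.succ y *
          ((R x - R y) ^ (N - 1 - k) / (N - 1 - k).factorial)) k g) := by
      intro g
      rw [← Finset.mul_sum]
      ring
    simp only [e2]
    have hci : ∀ k : Fin N, Continuous fun g => ρ g * iterTail ρ x (fun y => ρ y * φ k.succ y *
          ((R x - R y) ^ (N - 1 - k) / (N - 1 - k).factorial)) k g :=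
      fun k => hρ.mul (continuous_iterTail hρ (hcont k) x k)
    rw [intervalIntegral.integral_add, intervalIntegral.integral_add,
      intervalIntegral.integral_finsetSum, Fin.sum_univ_succ]
    · congr 1
      · rw [intervalIntegral.integral_const_mul]
        congr 1
        have hd : ∀ g ∈ Set.uIcc lo x, HasDerivAt
            (fun g => -((R x - R g) ^ (N + 1) / (N + 1).factorial))
            (ρ g * ((R x - R g) ^ N / N.factorial)) g := by
          intro g _
          -- Passing to `-R` based at `-R x` produces the powers of `R x - R g`.
          have h := (hasDerivAt_pow_div_factorial (ρ := fun g => -ρ g) (R := fun g => -R g)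
            (fun g => (hR g).neg) (-R x) N g).neg
          convert! h using 1
          · ext g; simp only [sub_neg_eq_add, Pi.neg_apply]; ring_nf
          · ring_nf
        rw [intervalIntegral.integral_eq_sub_of_hasDerivAt hd
          (Continuous.intervalIntegrable (by fun_prop) _ _)]
        simp
      · congr 1
        · exact intervalIntegral.integral_congr fun g _ => by simp
        · refine Finset.sum_congr rfl fun k _ => ?_
          have := iterTail_eq hρ (hcont k) hR x lo (k + 1)
          change ∫ y in lo..x, _ = _ at this
          rw [this]
          refine intervalIntegral.integral_congr fun y _ => ?_
          simp only [Fin.val_succ, add_tsub_cancel_right]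
          rw [show N - (↑k + 1) = N - 1 - ↑k by omega]
    · intro k _
      exact (hci k).intervalIntegrable _ _
    · exact Continuous.intervalIntegrable (by fun_prop) _ _
    · exact (continuous_finsetSum _ fun k _ => hci k).intervalIntegrable _ _
    · exact Continuous.intervalIntegrable (by fun_prop) _ _
    · exact Continuous.intervalIntegrable
        (Continuous.add (by fun_prop) (continuous_finsetSum _ fun k _ => hci k)) _ _

end NestedIntegral

/-! ### Binomial identities behind the sum over weak links -/

section Algebra

theorem factorial_add_two_div (m k : ℕ) (hk : k < m) :
    ((m + 1).factorial : ℝ) / (k.factorial * (m - 1 - k).factorial) =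
      ((m - k : ℕ) : ℝ) * ((m + 1) * m.choose k) := by
  have h1 : m.choose k * k.factorial * (m - k).factorial = m.factorial :=
    Nat.choose_mul_factorial_mul_factorial hk.le
  have h2 : (m - k).factorial = (m - k) * (m - 1 - k).factorial := by
    rw [show m - k = (m - 1 - k) + 1 by omega, Nat.factorial_succ]
  have h3 : (m + 1).factorial = (m + 1) *
      (m.choose k * k.factorial * ((m - k) * (m - 1 - k).factorial)) := by
    rw [Nat.factorial_succ, ← h2, h1]
  rw [h3]
  have a1 : (k.factorial : ℝ) ≠ 0 := by positivity
  have a2 : ((m - 1 - k).factorial : ℝ) ≠ 0 := by positivity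
  push_cast
  field_simp

/-- The sum over the number `N` of weak links, for a fixed rank `k` of the selected one. -/
theorem sum_descFactorial_mul (m k : ℕ) (hk : k < m) (E z : ℝ) :
    ∑ j ∈ Finset.range (m - k), ((m + 1).descFactorial (k + j + 1) : ℝ) * z ^ (m - (k + j)) *
      (((m : ℝ) - (k + j : ℕ)) * ((E - z) ^ j / j.factorial / k.factorial)) =
    z * ((m - k : ℕ) * ((m + 1) * m.choose k)) * E ^ (m - 1 - k) := by
  have hE : E ^ (m - 1 - k) = ((E - z) + z) ^ (m - 1 - k) := by ring
  rw [hE, add_pow, Finset.mul_sum, show m - 1 - k + 1 = m - k by omega]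
  refine Finset.sum_congr rfl fun j hj => ?_
  have hj' : j < m - k := Finset.mem_range.1 hj
  rw [← factorial_add_two_div m k hk]
  have h1 : (m - (k + j)).factorial * (m + 1).descFactorial (k + j + 1) = (m + 1).factorial := by
    have := Nat.factorial_mul_descFactorial (n := m + 1) (k := k + j + 1) (by omega)
    rwa [show m + 1 - (k + j + 1) = m - (k + j) by omega] at this
  have h2 : (m - 1 - k).choose j * j.factorial * (m - 1 - k - j).factorial =
      (m - 1 - k).factorial := Nat.choose_mul_factorial_mul_factorial (by omega)
  have h3 : (m - (k + j)).factorial = (m - (k + j)) * (m - 1 - k - j).factorial := by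
    rw [show m - (k + j) = (m - 1 - k - j) + 1 by omega, Nat.factorial_succ]
  have h4 : z ^ (m - (k + j)) = z ^ (m - 1 - k - j) * z := by
    rw [← pow_succ]; congr 1; omega
  have h5 : ((m : ℝ) - (k + j : ℕ)) = ((m - (k + j) : ℕ) : ℝ) := by
    rw [Nat.cast_sub (by omega)]
  rw [← h1, ← h2, h3, h4, h5]
  have a1 : (k.factorial : ℝ) ≠ 0 := by positivity
  have a2 : (j.factorial : ℝ) ≠ 0 := by positivity
  have a3 : ((m - 1 - k - j).factorial : ℝ) ≠ 0 := by positivity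
  have a4 : ((m - 1 - k).choose j : ℝ) ≠ 0 := by
    have := Nat.choose_pos (show j ≤ m - 1 - k by omega)
    positivity
  push_cast
  field_simp

theorem sum_choose_mul (m : ℕ) (A G : ℝ) :
    ∑ k ∈ Finset.range m, ((m : ℝ) + 1) * m.choose k * A ^ (m - k) * G ^ k =
      (m + 1) * ((A + G) ^ m - G ^ m) := by
  rw [add_comm A G, add_pow, Finset.sum_range_succ]
  simp only [Nat.sub_self, pow_zero, mul_one, Nat.choose_self, Nat.cast_one, add_sub_cancel_right,
    Finset.mul_sum]
  exact Finset.sum_congr rfl fun k _ => by ring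

theorem sum_sub_mul_choose_mul (m : ℕ) (A G : ℝ) :
    ∑ k ∈ Finset.range m, ((m : ℝ) - k) * (m + 1).choose k * A ^ (m + 1 - k) * G ^ k =
      (m + 1) * A * (A + G) ^ m - (A + G) ^ (m + 1) + G ^ (m + 1) := by
  -- The range is extended by `k = m`, of weight zero, and `k = m + 1`, which contributes `-G ^ (m +
  -- 1)`. On the full range write `m - k = (m + 1 - k) - 1` and absorb the first factor into the
  -- binomial coefficient.
  have h1 : ∑ k ∈ Finset.range (m + 2), ((m : ℝ) - k) * (m + 1).choose k * A ^ (m + 1 - k) * G ^ k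
      = (m + 1) * A * (A + G) ^ m - (A + G) ^ (m + 1) := by
    rw [add_comm A G, add_pow G A (m + 1), add_pow, Finset.sum_range_succ _ (m + 1),
      Finset.sum_range_succ _ (m + 1), ← sub_sub, Finset.mul_sum, ← Finset.sum_sub_distrib]
    rw [sub_eq_add_neg]
    congr 1
    · refine Finset.sum_congr rfl fun k hk => ?_
      have hk' : k < m + 1 := Finset.mem_range.1 hk
      have hc : (m.choose k : ℝ) * (m + 1) = (m + 1).choose k * (m + 1 - k) := by
        have := Nat.choose_mul_succ_eq m k
        have h := congrArg (Nat.cast : ℕ → ℝ) this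
        push_cast [Nat.cast_sub hk'.le] at h
        exact h
      have hp : A ^ (m + 1 - k) = A * A ^ (m - k) := by
        rw [← pow_succ']; congr 1; omega
      rw [hp]
      linear_combination (-1 : ℝ) * A * A ^ (m - k) * G ^ k * hc
    · simp
  rw [Finset.sum_range_succ, Finset.sum_range_succ] at h1
  simp only [sub_self, zero_mul, add_zero, Nat.choose_self, Nat.cast_one, mul_one] at h1
  rw [Nat.sub_self, pow_zero] at h1
  push_cast at h1
  linarith

/-- To be used with `E = e^{-y/s}`, `z = e^{-x/s}` and `F` the value of `maxCDF` at `y`. For fixed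
rank `k` the sum over `N` is a binomial expansion of `((E - z) + z)^(m-1-k)`. The extra factor `E`
turns the remaining powers into powers of `E * F`, so that the sum over `k` is binomial as well. -/
theorem mul_sum_selection (m : ℕ) (E z F : ℝ) (hE : E ≠ 0) :
    E * ∑ N ∈ Finset.Icc 1 m, ((m + 1).descFactorial N : ℝ) * z ^ (m + 1 - N) *
      ∑ k ∈ Finset.range N, (((m + 1 : ℕ) : ℝ) - N) *
        (F ^ (m + 1 - (k + 1)) / (((m + 1 : ℕ) : ℝ) - (k + 1)) -
          F ^ (m + 1 - (k + 1) + 1) / (((m + 1 : ℕ) : ℝ) - (k + 1) + 1)) *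
        ((E - z) ^ (N - 1 - k) / (N - 1 - k).factorial) * ((1 - E) ^ k / k.factorial) =
    z * ((m + 1) * (1 - F) * (E * F + (1 - E)) ^ m - (m + 1) * (1 - E) ^ m +
      ((E * F + (1 - E)) ^ (m + 1) - (1 - E) ^ (m + 1)) / E) := by
  -- Exchange of the two sums, with `N = k + j + 1`.
  have e1 : ∀ f : ℕ → ℕ → ℝ, ∑ N ∈ Finset.Icc 1 m, ∑ k ∈ Finset.range N, f N k =
      ∑ k ∈ Finset.range m, ∑ j ∈ Finset.range (m - k), f (k + j + 1) k := by
    intro f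
    have : ∀ k ∈ Finset.range m, ∑ j ∈ Finset.range (m - k), f (k + j + 1) k =
        ∑ n ∈ Finset.Ico k m, f (n + 1) k := by
      intro k _
      rw [Finset.sum_Ico_eq_sum_range]
    have hI : Finset.Icc 1 m = Finset.Ico (0 + 1) (m + 1) := by
      ext N; simp only [Finset.mem_Icc, Finset.mem_Ico]; omega
    rw [Finset.sum_congr rfl this, hI,
      ← Finset.sum_Ico_add' (fun N => ∑ k ∈ Finset.range N, f N k) 0 m 1]
    refine (Finset.sum_comm' ?_)
    intro n k
    simp only [Finset.mem_Ico, Finset.mem_range]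
    omega
  simp only [Finset.mul_sum]
  rw [e1]
  have e2 : ∀ k ∈ Finset.range m, ∑ j ∈ Finset.range (m - k),
      E * (((m + 1).descFactorial (k + j + 1) : ℝ) * z ^ (m + 1 - (k + j + 1)) *
        ((((m + 1 : ℕ) : ℝ) - (k + j + 1 : ℕ)) *
        (F ^ (m + 1 - (k + 1)) / (((m + 1 : ℕ) : ℝ) - (k + 1)) -
          F ^ (m + 1 - (k + 1) + 1) / (((m + 1 : ℕ) : ℝ) - (k + 1) + 1)) *
        ((E - z) ^ (k + j + 1 - 1 - k) / (k + j + 1 - 1 - k).factorial) *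
          ((1 - E) ^ k / k.factorial))) =
      z * (((m : ℝ) + 1) * m.choose k * (E * F) ^ (m - k) * (1 - E) ^ k -
        ((m : ℝ) - k) * (m + 1).choose k * (E * F) ^ (m + 1 - k) * (1 - E) ^ k / E) := by
    intro k hk
    have hk' : k < m := Finset.mem_range.1 hk
    have h0 := sum_descFactorial_mul m k hk' E z
    have hd : (((m + 1 : ℕ) : ℝ) - (k + 1)) = (m - k : ℕ) := by
      rw [Nat.cast_sub hk'.le]; push_cast; ring
    have hpos : (0 : ℝ) < (m - k : ℕ) := by
      have : 0 < m - k := by omega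
      positivity
    -- This absorption cancels the denominator `m - k + 1`; the other one, `m - k`, is cancelled by
    -- the factor from `sum_descFactorial_mul`.
    have hc : (m.choose k : ℝ) * (m + 1) = (m + 1).choose k * ((m - k : ℕ) + 1) := by
      have := Nat.choose_mul_succ_eq m k
      rw [show m + 1 - k = (m - k) + 1 by omega] at this
      have h := congrArg (Nat.cast : ℕ → ℝ) this
      push_cast at h
      exact h
    calc _ = (∑ j ∈ Finset.range (m - k), ((m + 1).descFactorial (k + j + 1) : ℝ) *
          z ^ (m - (k + j)) * (((m : ℝ) - (k + j : ℕ)) *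
            ((E - z) ^ j / j.factorial / k.factorial))) *
          (E * (F ^ (m - k) / (m - k : ℕ) - F ^ (m - k + 1) / ((m - k : ℕ) + 1)) *
            (1 - E) ^ k) := by
          rw [Finset.sum_mul]
          refine Finset.sum_congr rfl fun j _ => ?_
          rw [hd, show m + 1 - (k + j + 1) = m - (k + j) by omega,
            show m + 1 - (k + 1) = m - k by omega, show k + j + 1 - 1 - k = j by omega]
          push_cast
          ring
      _ = z * (1 - E) ^ k * (E * E ^ (m - 1 - k)) * (((m : ℝ) + 1) * m.choose k * F ^ (m - k) -
            ((m - k : ℕ) : ℝ) * ((m.choose k : ℝ) * (m + 1)) / ((m - k : ℕ) + 1) *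
              F ^ (m - k + 1)) := by
          rw [h0]
          field_simp
      _ = _ := by
          rw [hc, ← pow_succ', show m - 1 - k + 1 = m - k by omega,
            show m + 1 - k = m - k + 1 by omega, mul_pow, mul_pow, pow_succ E]
          rw [Nat.cast_sub hk'.le] at hpos ⊢
          have : (m : ℝ) - k + 1 ≠ 0 := by linarith
          field_simp
  rw [Finset.sum_congr rfl e2, ← Finset.mul_sum, Finset.sum_sub_distrib, ← Finset.sum_div,
    sum_choose_mul, sum_sub_mul_choose_mul]
  congr 1
  field_simp
  ring

end Algebra

/-! ### Closed form of `windowTail` and its exponential expansion -/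

section ClosedForm

/-- CDF of the maximum of `M` independent exponential variables of mean `s`. -/
noncomputable def maxCDF (M : ℕ) (s v : ℝ) : ℝ := (1 - Real.exp (-v / s)) ^ M

/-- Density of the maximum of `M` independent exponential variables of mean `s`. -/
noncomputable def maxPDF (M : ℕ) (s v : ℝ) : ℝ :=
  M * (1 - Real.exp (-v / s)) ^ (M - 1) * (1 / s * Real.exp (-v / s))

/-- CDF of the best two-hop path through a given relay. -/
noncomputable def pathCDF (M : ℕ) (s v : ℝ) : ℝ :=
  1 - Real.exp (-v / s) * (1 - maxCDF M s v)

theorem continuous_maxCDF (M : ℕ) (s : ℝ) : Continuous (maxCDF M s) := by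
  unfold maxCDF; fun_prop

theorem continuous_maxPDF (M : ℕ) (s : ℝ) : Continuous (maxPDF M s) := by
  unfold maxPDF; fun_prop

theorem continuous_pathCDF (M : ℕ) (s : ℝ) : Continuous (pathCDF M s) := by
  unfold pathCDF maxCDF; fun_prop

theorem hasDerivAt_exp_neg_div (s v : ℝ) :
    HasDerivAt (fun v => Real.exp (-v / s)) (-(1 / s * Real.exp (-v / s))) v := by
  have h := ((hasDerivAt_id v).neg.div_const s).exp
  convert! h using 1
  simp
  ring

theorem hasDerivAt_maxCDF (M : ℕ) (s v : ℝ) : HasDerivAt (maxCDF M s) (maxPDF M s v) v := by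
  have h := ((hasDerivAt_exp_neg_div s v).const_sub 1).pow M
  convert! h using 1
  simp [maxPDF]

theorem hasDerivAt_pathCDF (M : ℕ) (s v : ℝ) : HasDerivAt (pathCDF M s)
    (1 / s * Real.exp (-v / s) * (1 - maxCDF M s v) + Real.exp (-v / s) * maxPDF M s v) v := by
  have h := ((hasDerivAt_exp_neg_div s v).mul ((hasDerivAt_maxCDF M s v).const_sub 1)).const_sub 1
  convert! h using 1
  ring

theorem nestedIntegral_selectionProb (M N : ℕ) (s x : ℝ) :
    nestedIntegral (fun g => 1 / s * Real.exp (-g / s)) x N 0 (selectionProb M N s) =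
      ∫ y in (0 : ℝ)..x, 1 / s * Real.exp (-y / s) *
        ∑ k ∈ Finset.range N, ((M : ℝ) - N) *
        (maxCDF M s y ^ (M - (k + 1)) / ((M : ℝ) - (k + 1)) -
          maxCDF M s y ^ (M - (k + 1) + 1) / ((M : ℝ) - (k + 1) + 1)) *
        ((Real.exp (-y / s) - Real.exp (-x / s)) ^ (N - 1 - k) / (N - 1 - k).factorial) *
        ((1 - Real.exp (-y / s)) ^ k / k.factorial) := by
  have hsel : selectionProb M N s = fun g : Fin N → ℝ => 0 + ∑ k : Fin N,
      (fun y => ((M : ℝ) - N) * (maxCDF M s y ^ (M - ((k : ℕ) + 1)) / ((M : ℝ) - (k + 1)) -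
          maxCDF M s y ^ (M - ((k : ℕ) + 1) + 1) / ((M : ℝ) - (k + 1) + 1))) (g k) := by
    funext g
    simp only [selectionProb, maxCDF, zero_add, ← pow_mul]
  -- With `R = -e^{-g/s}` the increments are `R x - R y = e^{-y/s} - e^{-x/s}` and `R y - R 0 = 1 -
  -- e^{-y/s}`.
  have hR : ∀ g, HasDerivAt (fun g => -Real.exp (-g / s)) (1 / s * Real.exp (-g / s)) g := by
    intro g
    convert! (hasDerivAt_exp_neg_div s g).neg using 1
    simp
  have hc := continuous_maxCDF M s
  have hnest := nestedIntegral_const_add_sum (by fun_prop) hR x N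
    (fun (k : Fin N) y => ((M : ℝ) - N) *
      (maxCDF M s y ^ (M - ((k : ℕ) + 1)) / ((M : ℝ) - (k + 1)) -
        maxCDF M s y ^ (M - ((k : ℕ) + 1) + 1) / ((M : ℝ) - (k + 1) + 1)))
    (by intro k; fun_prop) 0 0
  rw [hsel, hnest]
  simp only [Finset.sum_range, Finset.mul_sum, zero_mul, zero_add]
  rw [intervalIntegral.integral_finsetSum]
  · refine Finset.sum_congr rfl fun k _ => intervalIntegral.integral_congr fun y _ => ?_
    simp only [neg_zero, zero_div, Real.exp_zero, sub_neg_eq_add]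
    rw [neg_add_eq_sub, neg_add_eq_sub]
    ring
  · intro k _
    exact Continuous.intervalIntegrable (by fun_prop) _ _

/-- The right-hand side is an antiderivative that vanishes at `0`. Differentiating the quotient
produces a term `(m + 1) * maxPDF * pathCDF ^ m`, which the subtracted integral removes. -/
theorem integral_selection (m : ℕ) (s x : ℝ) (hs : s ≠ 0) :
    ∫ y in (0 : ℝ)..x, 1 / s * (((m : ℝ) + 1) * (1 - maxCDF (m + 1) s y) *
        pathCDF (m + 1) s y ^ m - (m + 1) * (1 - Real.exp (-y / s)) ^ m +
        (pathCDF (m + 1) s y ^ (m + 1) - (1 - Real.exp (-y / s)) ^ (m + 1)) /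
          Real.exp (-y / s)) =
      (pathCDF (m + 1) s x ^ (m + 1) - (1 - Real.exp (-x / s)) ^ (m + 1)) / Real.exp (-x / s) -
      (m + 1) * ∫ y in (0 : ℝ)..x, maxPDF (m + 1) s y * pathCDF (m + 1) s y ^ m := by
  have c1 := continuous_maxCDF (m + 1) s
  have c2 := continuous_maxPDF (m + 1) s
  have c3 := continuous_pathCDF (m + 1) s
  have c4 : Continuous fun y : ℝ => Real.exp (-y / s) := by fun_prop
  have hd : ∀ y ∈ Set.uIcc 0 x, HasDerivAt (fun y =>
      (pathCDF (m + 1) s y ^ (m + 1) - (1 - Real.exp (-y / s)) ^ (m + 1)) / Real.exp (-y / s) -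
      (m + 1) * ∫ y in (0 : ℝ)..y, maxPDF (m + 1) s y * pathCDF (m + 1) s y ^ m)
      (1 / s * (((m : ℝ) + 1) * (1 - maxCDF (m + 1) s y) *
        pathCDF (m + 1) s y ^ m - (m + 1) * (1 - Real.exp (-y / s)) ^ m +
        (pathCDF (m + 1) s y ^ (m + 1) - (1 - Real.exp (-y / s)) ^ (m + 1)) /
          Real.exp (-y / s))) y := by
    intro y _
    have hI : HasDerivAt (fun y => ∫ y in (0 : ℝ)..y, maxPDF (m + 1) s y * pathCDF (m + 1) s y ^ m)
        (maxPDF (m + 1) s y * pathCDF (m + 1) s y ^ m) y :=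
      intervalIntegral.integral_hasDerivAt_right
        (Continuous.intervalIntegrable (by fun_prop) _ _)
        (Continuous.stronglyMeasurableAtFilter (by fun_prop) _ _)
        (Continuous.continuousAt (by fun_prop))
    have hE := hasDerivAt_exp_neg_div s y
    have hne : Real.exp (-y / s) ≠ 0 := (Real.exp_pos _).ne'
    have h := ((((hasDerivAt_pathCDF (m + 1) s y).pow (m + 1)).sub
      ((hE.const_sub 1).pow (m + 1))).div hE hne).sub (hI.const_mul ((m : ℝ) + 1))
    convert! h using 1
    push_cast
    simp only [Pi.pow_apply, Pi.sub_apply]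
    field_simp
    ring
  rw [intervalIntegral.integral_eq_sub_of_hasDerivAt hd]
  · simp [pathCDF, maxCDF]
  · exact Continuous.intervalIntegrable
      (by fun_prop (disch := intro y; exact (Real.exp_pos _).ne')) _ _

/-- The link between the stated nested integrals and the probability of a window. On multiplying
`integral_selection` by `e^{-x/s}`, the powers of `1 - e^{-x/s}` cancel against those in
`windowTail`. -/
theorem windowTail_eq (m : ℕ) {s : ℝ} (hs : s ≠ 0) (x : ℝ) :
    windowTail (m + 1) s x = 1 - pathCDF (m + 1) s x ^ (m + 1) +
      (m + 1) * Real.exp (-x / s) *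
        ∫ y in (0 : ℝ)..x, maxPDF (m + 1) s y * pathCDF (m + 1) s y ^ m := by
  have c1 := continuous_maxCDF (m + 1) s
  set z := Real.exp (-x / s) with hz
  have hz0 : z ≠ 0 := (Real.exp_pos _).ne'
  have h1 : ∑ N ∈ Finset.Icc 1 (m + 1 - 1), ((m + 1).descFactorial N : ℝ) *
      Real.exp (-(((m + 1 : ℕ) : ℝ) - N) * x / s) *
        nestedIntegral (fun g => 1 / s * Real.exp (-g / s)) x N 0 (selectionProb (m + 1) N s) =
      ∫ y in (0 : ℝ)..x, 1 / s * (z * (((m : ℝ) + 1) * (1 - maxCDF (m + 1) s y) *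
        pathCDF (m + 1) s y ^ m - (m + 1) * (1 - Real.exp (-y / s)) ^ m +
        (pathCDF (m + 1) s y ^ (m + 1) - (1 - Real.exp (-y / s)) ^ (m + 1)) /
          Real.exp (-y / s))) := by
    have h2 : ∀ y, 1 / s * (z * (((m : ℝ) + 1) * (1 - maxCDF (m + 1) s y) *
        pathCDF (m + 1) s y ^ m - (m + 1) * (1 - Real.exp (-y / s)) ^ m +
        (pathCDF (m + 1) s y ^ (m + 1) - (1 - Real.exp (-y / s)) ^ (m + 1)) /
          Real.exp (-y / s))) = _ := fun y => by
      have := mul_sum_selection m (Real.exp (-y / s)) z (maxCDF (m + 1) s y) (Real.exp_pos _).ne'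
      have hp : pathCDF (m + 1) s y =
          Real.exp (-y / s) * maxCDF (m + 1) s y + (1 - Real.exp (-y / s)) := by
        simp only [pathCDF]; ring
      rw [hp, ← this]
    simp only [h2]
    rw [Nat.add_sub_cancel]
    simp only [← mul_assoc]
    simp only [Finset.mul_sum (s := Finset.Icc 1 m)]
    rw [intervalIntegral.integral_finsetSum]
    · refine Finset.sum_congr rfl fun N hN => ?_
      have hN' := Finset.mem_Icc.1 hN
      have he : Real.exp (-(((m + 1 : ℕ) : ℝ) - N) * x / s) = z ^ (m + 1 - N) := by
        rw [hz, ← Real.exp_nat_mul, Nat.cast_sub (by omega)]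
        congr 1
        ring
      rw [nestedIntegral_selectionProb, he,
        ← intervalIntegral.integral_const_mul]
      refine intervalIntegral.integral_congr fun y _ => ?_
      simp only [← hz]
      ring
    · intro N _
      exact Continuous.intervalIntegrable (by fun_prop) _ _
  rw [windowTail, h1]
  have h3 : ∀ y, 1 / s * (z * (((m : ℝ) + 1) * (1 - maxCDF (m + 1) s y) *
        pathCDF (m + 1) s y ^ m - (m + 1) * (1 - Real.exp (-y / s)) ^ m +
        (pathCDF (m + 1) s y ^ (m + 1) - (1 - Real.exp (-y / s)) ^ (m + 1)) /
          Real.exp (-y / s))) = z * _ := fun y => mul_left_comm _ _ _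
  simp only [h3]
  rw [intervalIntegral.integral_const_mul, integral_selection m s x hs, ← hz]
  field_simp
  ring

/-- `windowTail` as a polynomial in `e^{-x/s}`. -/
theorem exists_polynomial_windowTail (m : ℕ) : ∃ p : Polynomial ℝ,
    p.natDegree ≤ (m + 1) ^ 2 + (m + 1) ∧ p.coeff 0 = 0 ∧
      ∀ s : ℝ, s ≠ 0 → ∀ x : ℝ, p.eval (Real.exp (-x / s)) = windowTail (m + 1) s x := by
  open Polynomial in
  let F : ℝ[X] := (1 - X) ^ (m + 1)
  -- With `u = e^{-y/s}`, `F` and `Φ` represent `maxCDF` and `pathCDF`; the factor `u / s` of the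
  -- density is absorbed by `du`, so the integral becomes that of `w` from `e^{-x/s}` to `1`.
  let Φ : ℝ[X] := 1 - X * (1 - F)
  let w : ℝ[X] := (C ((m : ℝ) + 1) * (1 - X) ^ m) * Φ ^ m
  have hX : (1 - X : ℝ[X]).natDegree ≤ 1 := by
    refine (natDegree_sub_le _ _).trans ?_
    simp
  have hF : F.natDegree ≤ m + 1 := by
    exact (natDegree_pow_le_of_le (m + 1) hX).trans (mul_one _).le
  have hΦ : Φ.natDegree ≤ m + 2 := by
    refine (natDegree_sub_le _ _).trans ?_
    have h1 : (1 - F).natDegree ≤ m + 1 := (natDegree_sub_le _ _).trans (by simpa using hF)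
    have h2 : (X * (1 - F)).natDegree ≤ 1 + (m + 1) :=
      natDegree_mul_le_of_le natDegree_X_le h1
    simp only [natDegree_one]
    omega
  have hw : w.natDegree ≤ (0 + m * 1) + m * (m + 2) :=
    natDegree_mul_le_of_le (natDegree_mul_le_of_le (natDegree_C _).le
      (natDegree_pow_le_of_le m hX)) (natDegree_pow_le_of_le m hΦ)
  obtain ⟨W, hWd, hW⟩ : ∃ W : ℝ[X], W.natDegree ≤ w.natDegree + 1 ∧ derivative W = w := by
    refine ⟨w.sum fun n a => monomial (n + 1) (a / (n + 1)), ?_, ?_⟩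
    · refine natDegree_sum_le_of_forall_le _ _ fun n hn => ?_
      exact (natDegree_monomial_le _).trans (Nat.succ_le_succ (le_natDegree_of_mem_supp n hn))
    · rw [sum_def, derivative_sum]
      conv_rhs => rw [w.as_sum_support]
      refine Finset.sum_congr rfl fun n _ => ?_
      rw [derivative_monomial]
      congr 1
      push_cast
      field_simp
  refine ⟨1 - Φ ^ (m + 1) + C ((m : ℝ) + 1) * X * (C (W.eval 1) - W), ?_, ?_, ?_⟩
  · have h1 : (Φ ^ (m + 1)).natDegree ≤ (m + 1) * (m + 2) := natDegree_pow_le_of_le (m + 1) hΦ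
    have h2 : (1 - Φ ^ (m + 1)).natDegree ≤ (m + 1) * (m + 2) :=
      (natDegree_sub_le _ _).trans (by simpa using h1)
    have h3 : (C (W.eval 1) - W).natDegree ≤ m + m * (m + 2) + 1 :=
      (natDegree_sub_le _ _).trans (by simp only [natDegree_C]; omega)
    have h4 : (C ((m : ℝ) + 1) * X * (C (W.eval 1) - W)).natDegree ≤
        (0 + 1) + (m + m * (m + 2) + 1) :=
      natDegree_mul_le_of_le (natDegree_mul_le_of_le (natDegree_C _).le natDegree_X_le) h3
    refine (natDegree_add_le _ _).trans (max_le ?_ ?_)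
    · refine h2.trans (le_of_eq (by ring))
    · refine h4.trans (le_of_eq (by ring))
  · simp [coeff_zero_eq_eval_zero, Φ]
  · intro s hs x
    rw [windowTail_eq m hs]
    have hF' : ∀ y, F.eval (Real.exp (-y / s)) = maxCDF (m + 1) s y := by
      intro y; simp [F, maxCDF]
    have hΦ' : ∀ y, Φ.eval (Real.exp (-y / s)) = pathCDF (m + 1) s y := by
      intro y
      simp [Φ, pathCDF, hF']
    have hint : ∫ y in (0 : ℝ)..x, maxPDF (m + 1) s y * pathCDF (m + 1) s y ^ m =
        W.eval 1 - W.eval (Real.exp (-x / s)) := by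
      have hd : ∀ y ∈ Set.uIcc 0 x, HasDerivAt (fun y => -W.eval (Real.exp (-y / s)))
          (maxPDF (m + 1) s y * pathCDF (m + 1) s y ^ m) y := by
        intro y _
        have h := ((W.hasDerivAt (Real.exp (-y / s))).comp y (hasDerivAt_exp_neg_div s y)).neg
        convert! h using 1
        rw [hW, ← hΦ']
        simp [w, maxPDF]
        ring
      have c2 := continuous_maxPDF (m + 1) s
      have c3 := continuous_pathCDF (m + 1) s
      rw [intervalIntegral.integral_eq_sub_of_hasDerivAt hd
        (Continuous.intervalIntegrable (by fun_prop) _ _)]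
      simp
      ring
    rw [hint, ← hΦ' x]
    simp

theorem exists_exponential_sum_windowTail {M : ℕ} (hM : 2 ≤ M) :
    ∃ a b : Fin (M ^ 2 * (M ^ 2 - 1)) → ℝ, (∀ q, 0 < b q) ∧
      ∀ s : ℝ, 0 < s → ∀ x : ℝ, 0 ≤ x →
        ∑ q, a q * Real.exp (-b q * x / s) = windowTail M s x := by
  obtain ⟨m, rfl⟩ : ∃ m, M = m + 1 := ⟨M - 1, by omega⟩
  obtain ⟨p, hd, h0, hp⟩ := exists_polynomial_windowTail m
  -- The exponents are `1, 2, …`, since the constant coefficient is zero. Degree at most `M² + M`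
  -- leaves room in `M² (M² - 1)` terms once `M ≥ 2`; surplus coefficients are zero.
  refine ⟨fun q => p.coeff (q + 1), fun q => (q : ℝ) + 1, fun q => by positivity, ?_⟩
  intro s hs x _
  rw [← hp s hs.ne' x]
  have hlt : p.natDegree < (m + 1) ^ 2 * ((m + 1) ^ 2 - 1) + 1 := by
    have h1 : 2 ≤ (m + 1) ^ 2 - 1 := by
      have : 2 ^ 2 ≤ (m + 1) ^ 2 := Nat.pow_le_pow_left hM 2
      omega
    nlinarith [Nat.mul_le_mul_left ((m + 1) ^ 2) h1]
  rw [Polynomial.eval_eq_sum_range' hlt, Finset.sum_range_succ', h0, zero_mul, add_zero,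
    Finset.sum_range]
  refine Finset.sum_congr rfl fun q _ => ?_
  rw [← Real.exp_nat_mul]
  congr 2
  push_cast
  ring

end ClosedForm

/-! ### Squared modulus of a Rayleigh coefficient -/

section RayleighLaw

open Set in
theorem lintegral_two_mul_exp_neg_sq {v : ℝ} (hv : 0 < v) {y : ℝ} (hy : 0 ≤ y) :
    ∫⁻ r in Ioi (√y), ENNReal.ofReal (2 * r / v * Real.exp (-r ^ 2 / v)) =
      ENNReal.ofReal (Real.exp (-y / v)) := by
  have hd : ∀ r ∈ Ici (√y), HasDerivAt (fun r => -Real.exp (-r ^ 2 / v))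
      (2 * r / v * Real.exp (-r ^ 2 / v)) r := by
    intro r _
    have h := ((((hasDerivAt_id r).pow 2).neg.div_const v).exp).neg
    convert! h using 1
    simp
    ring
  have hnn : ∀ r ∈ Ioi (√y), 0 ≤ 2 * r / v * Real.exp (-r ^ 2 / v) := by
    intro r hr
    have : 0 ≤ r := (Real.sqrt_nonneg y).trans (le_of_lt hr)
    positivity
  have ht : Filter.Tendsto (fun r : ℝ => -Real.exp (-r ^ 2 / v)) Filter.atTop (nhds (-0)) := by
    refine Filter.Tendsto.neg (Real.tendsto_exp_atBot.comp ?_)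
    refine Filter.Tendsto.atBot_div_const hv ?_
    exact Filter.tendsto_neg_atTop_atBot.comp (Filter.tendsto_pow_atTop two_ne_zero)
  rw [← ofReal_integral_eq_lintegral_ofReal
      (integrableOn_Ioi_deriv_of_nonneg' hd hnn ht)
      ((ae_restrict_iff' measurableSet_Ioi).2 (ae_of_all _ hnn)),
    integral_Ioi_of_hasDerivAt_of_nonneg' hd hnn ht]
  simp [Real.sq_sqrt hy]

-- In polar coordinates the Gaussian density depends on the radius only. The angle contributes `2π`,
-- and the radial integrand `2r/v e^{-r²/v}` has an elementary antiderivative: `‖z‖²` is exponential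
-- of mean `v`.
open Set in
theorem rayleighFading_lt_norm_sq {v : ℝ} (hv : 0 < v) {y : ℝ} (hy : 0 ≤ y) :
    rayleighFading v {z | y < ‖z‖ ^ 2} = ENNReal.ofReal (Real.exp (-y / v)) := by
  have hv2 : (v / 2).toNNReal ≠ 0 := by simpa using hv
  have hcoe : (((v / 2).toNNReal : NNReal) : ℝ) = v / 2 := Real.coe_toNNReal _ (by positivity)
  have hm : Measurable (fun p : ℝ × ℝ => (⟨p.1, p.2⟩ : ℂ)) :=
    Complex.measurableEquivRealProd.symm.measurable
  have hS : MeasurableSet {z : ℂ | y < ‖z‖ ^ 2} :=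
    measurableSet_lt measurable_const (by fun_prop)
  rw [rayleighFading, Measure.map_apply hm hS, gaussianReal_of_var_ne_zero _ hv2,
    prod_withDensity (by fun_prop) (by fun_prop), withDensity_apply _ (hm hS),
    ← lintegral_indicator (hm hS), ← Measure.volume_eq_prod, ← lintegral_comp_polarCoord_symm]
  have hpdf : ∀ a b : ℝ, gaussianPDF 0 (v / 2).toNNReal a * gaussianPDF 0 (v / 2).toNNReal b =
      ENNReal.ofReal ((Real.pi * v)⁻¹ * Real.exp (-(a ^ 2 + b ^ 2) / v)) := by
    intro a b
    rw [gaussianPDF, gaussianPDF, ← ENNReal.ofReal_mul (gaussianPDFReal_nonneg _ _ _)]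
    congr 1
    simp only [gaussianPDFReal, hcoe, sub_zero]
    have h1 : 2 * Real.pi * (v / 2) = Real.pi * v := by ring
    have h2 : 2 * (v / 2) = v := by ring
    rw [h1, h2, neg_add, add_div, Real.exp_add]
    have h3 : (√(Real.pi * v))⁻¹ * (√(Real.pi * v))⁻¹ = (Real.pi * v)⁻¹ := by
      rw [← mul_inv, Real.mul_self_sqrt (by positivity)]
    rw [← h3]
    ring
  have hpt : ∀ p ∈ polarCoord.target, ENNReal.ofReal p.1 •
      ((fun p : ℝ × ℝ => (⟨p.1, p.2⟩ : ℂ)) ⁻¹' {z | y < ‖z‖ ^ 2}).indicator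
        (fun z : ℝ × ℝ => gaussianPDF 0 (v / 2).toNNReal z.1 * gaussianPDF 0 (v / 2).toNNReal z.2)
        (polarCoord.symm p) =
      (Ioi (√y)).indicator (fun r => ENNReal.ofReal ((Real.pi * v)⁻¹ * r *
        Real.exp (-r ^ 2 / v))) p.1 * 1 := by
    rintro ⟨r, θ⟩ hp
    have hr : 0 < r := hp.1
    have hsq : (r * Real.cos θ) ^ 2 + (r * Real.sin θ) ^ 2 = r ^ 2 := by
      have := Real.cos_sq_add_sin_sq θ
      linear_combination r ^ 2 * this
    have hmem : (r * Real.cos θ, r * Real.sin θ) ∈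
        ((fun p : ℝ × ℝ => (⟨p.1, p.2⟩ : ℂ)) ⁻¹' {z | y < ‖z‖ ^ 2}) ↔ r ∈ Ioi (√y) := by
      simp only [mem_preimage, mem_ofPred_eq, mem_Ioi, Real.sqrt_lt' hr]
      rw [Complex.sq_norm, Complex.normSq_mk, ← sq, ← sq, hsq]
    simp only [polarCoord_symm_apply, smul_eq_mul, mul_one]
    by_cases h : r ∈ Ioi (√y)
    · rw [indicator_of_mem (hmem.2 h), indicator_of_mem h, hpdf, hsq,
        ← ENNReal.ofReal_mul hr.le]
      congr 1
      ring
    · rw [indicator_of_notMem (mt hmem.1 h), indicator_of_notMem h, mul_zero]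
  rw [setLIntegral_congr_fun polarCoord.open_target.measurableSet hpt, polarCoord_target,
    Measure.volume_eq_prod, ← Measure.prod_restrict,
    lintegral_prod_mul (Measurable.aemeasurable (Measurable.indicator (by fun_prop)
      measurableSet_Ioi)) aemeasurable_const]
  rw [lintegral_one, Measure.restrict_apply_univ, Real.volume_Ioo,
    lintegral_indicator measurableSet_Ioi, Measure.restrict_restrict measurableSet_Ioi,
    inter_eq_self_of_subset_left (Ioi_subset_Ioi (Real.sqrt_nonneg y)),
    ← lintegral_mul_const _ (by fun_prop), ← lintegral_two_mul_exp_neg_sq hv hy]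
  refine setLIntegral_congr_fun measurableSet_Ioi fun r hr => ?_
  have hr0 : 0 ≤ r := (Real.sqrt_nonneg y).trans (le_of_lt hr)
  rw [← ENNReal.ofReal_mul (by positivity)]
  congr 1
  have := Real.pi_ne_zero
  field_simp
  ring

end RayleighLaw

/-! ### Laws of maxima of exponential variables -/

section MaxLaw

/-- Law of the maximum of `M` independent exponential variables of mean `s`. -/
noncomputable def maxLaw (M : ℕ) (s : ℝ) : Measure ℝ :=
  (volume.restrict (Set.Ioi 0)).withDensity fun v => ENNReal.ofReal (maxPDF M s v)

instance (M : ℕ) (s : ℝ) : NullSingletonClass (maxLaw M s) := by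
  unfold maxLaw; infer_instance

theorem maxCDF_nonneg (M : ℕ) {s v : ℝ} (hs : 0 < s) (hv : 0 ≤ v) : 0 ≤ maxCDF M s v := by
  refine pow_nonneg (sub_nonneg.2 (Real.exp_le_one_iff.2 ?_)) M
  rw [neg_div]
  have : 0 ≤ v / s := by positivity
  linarith

theorem maxCDF_le_one (M : ℕ) {s v : ℝ} (hs : 0 < s) (hv : 0 ≤ v) : maxCDF M s v ≤ 1 := by
  refine pow_le_one₀ ?_ ?_
  · simpa [maxCDF] using maxCDF_nonneg 1 hs hv
  · have := Real.exp_pos (-v / s)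
    linarith

theorem maxPDF_nonneg (M : ℕ) {s v : ℝ} (hs : 0 < s) (hv : 0 ≤ v) : 0 ≤ maxPDF M s v := by
  have := maxCDF_nonneg (M - 1) hs hv
  unfold maxCDF at this
  unfold maxPDF
  positivity

theorem pathCDF_nonneg (M : ℕ) {s v : ℝ} (hs : 0 < s) (hv : 0 ≤ v) : 0 ≤ pathCDF M s v := by
  have h1 := maxCDF_nonneg M hs hv
  have h2 := maxCDF_le_one M hs hv
  have h3 : Real.exp (-v / s) ≤ 1 := by
    have := maxCDF_nonneg 1 hs hv
    simp only [maxCDF, pow_one] at this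
    linarith
  have h4 := Real.exp_pos (-v / s)
  unfold pathCDF
  nlinarith

theorem pathCDF_le_one (M : ℕ) {s v : ℝ} (hs : 0 < s) (hv : 0 ≤ v) : pathCDF M s v ≤ 1 :=
  sub_le_self _ (mul_nonneg (Real.exp_pos _).le (sub_nonneg.2 (maxCDF_le_one M hs hv)))

theorem integral_maxPDF_mul_pathCDF_nonneg (M m : ℕ) {s x : ℝ} (hs : 0 < s) (hx : 0 ≤ x) :
    0 ≤ ∫ v in (0 : ℝ)..x, maxPDF M s v * pathCDF M s v ^ m :=
  intervalIntegral.integral_nonneg hx fun _ hv =>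
    mul_nonneg (maxPDF_nonneg M hs hv.1) (pow_nonneg (pathCDF_nonneg M hs hv.1) m)

theorem setLIntegral_maxLaw (M : ℕ) {s : ℝ} (hs : 0 < s) {φ : ℝ → ℝ} (hφ : Continuous φ)
    (hφ0 : ∀ v, 0 ≤ v → 0 ≤ φ v) {x : ℝ} (hx : 0 ≤ x) :
    ∫⁻ v in Set.Iic x, ENNReal.ofReal (φ v) ∂(maxLaw M s) =
      ENNReal.ofReal (∫ v in (0 : ℝ)..x, maxPDF M s v * φ v) := by
  have hc := continuous_maxPDF M s
  rw [maxLaw, setLIntegral_withDensity_eq_setLIntegral_mul _ (by fun_prop) (by fun_prop)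
    measurableSet_Iic, Measure.restrict_restrict measurableSet_Iic, Set.inter_comm,
      Set.Ioi_inter_Iic,
    intervalIntegral.integral_of_le hx, ofReal_integral_eq_lintegral_ofReal]
  · refine setLIntegral_congr_fun measurableSet_Ioc fun v hv => ?_
    simp only [Pi.mul_apply]
    rw [ENNReal.ofReal_mul (maxPDF_nonneg M hs hv.1.le)]
  · exact (Continuous.integrableOn_Icc (by fun_prop)).mono_set Set.Ioc_subset_Icc_self
  · exact (ae_restrict_iff' measurableSet_Ioc).2 (ae_of_all _ fun v hv =>
      mul_nonneg (maxPDF_nonneg M hs hv.1.le) (hφ0 v hv.1.le))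

theorem maxLaw_Iic {M : ℕ} (hM : M ≠ 0) {s : ℝ} (hs : 0 < s) {y : ℝ} (hy : 0 ≤ y) :
    maxLaw M s (Set.Iic y) = ENNReal.ofReal (maxCDF M s y) := by
  have h := setLIntegral_maxLaw M hs continuous_const (fun _ _ => zero_le_one) hy
  simp only [ENNReal.ofReal_one, lintegral_one, Measure.restrict_apply_univ, mul_one] at h
  have h0 : maxCDF M s 0 = 0 := by simp [maxCDF, hM]
  rw [h, intervalIntegral.integral_eq_sub_of_hasDerivAt (fun v _ => hasDerivAt_maxCDF M s v)
    ((continuous_maxPDF M s).intervalIntegrable _ _), h0, sub_zero]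

/-- Identifies both kinds of variables in a window: single links (`M = 1`, the exponential law) and
best second hops. -/
theorem map_eq_maxLaw {Ω : Type*} [MeasurableSpace Ω] {μ : Measure Ω} [IsProbabilityMeasure μ]
    {M : ℕ} (hM : M ≠ 0) {s : ℝ} (hs : 0 < s) {Z : Ω → ℝ} (hZ : Measurable Z) (hZ0 : ∀ ω, 0 ≤ Z ω)
    (h : ∀ y, 0 ≤ y → μ {ω | Z ω ≤ y} = ENNReal.ofReal (maxCDF M s y)) :
    μ.map Z = maxLaw M s := by
  have := Measure.isProbabilityMeasure_map hZ.aemeasurable (μ := μ)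
  refine Measure.ext_of_Iic _ _ fun y => ?_
  rw [Measure.map_apply hZ measurableSet_Iic]
  rcases lt_or_ge y 0 with hy | hy
  · have h1 : Z ⁻¹' Set.Iic y = ∅ := by
      ext ω
      simpa using hy.trans_le (hZ0 ω)
    rw [h1, measure_empty, maxLaw, withDensity_apply _ measurableSet_Iic,
      Measure.restrict_restrict measurableSet_Iic, Set.inter_comm, Set.Ioi_inter_Iic,
      Set.Ioc_eq_empty (by linarith)]
    simp
  · rw [maxLaw_Iic hM hs hy]
    exact h y hy

end MaxLaw

/-! ### Independence of functions of disjoint blocks -/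

section Independence

variable {Ω ι κ : Type*}

/-- Induction on the finite family of blocks: each new block is independent of the supremum over the
union of the others, being indexed by a disjoint set. -/
theorem iIndep_iSup_of_pairwise_disjoint [mΩ : MeasurableSpace Ω] {μ : Measure Ω}
    [IsProbabilityMeasure μ] {m : ι → MeasurableSpace Ω}
    (h_le : ∀ i, m i ≤ mΩ) (h : iIndep m μ) {S : κ → Set ι}
    (hS : Pairwise (Function.onFun Disjoint S)) :
    iIndep (fun k => ⨆ i ∈ S k, m i) μ := by
  classical
  rw [iIndep_iff]
  intro s E hE
  induction s using Finset.induction_on with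
  | empty => simp
  | insert k s hk ih =>
    rw [Finset.prod_insert hk, Finset.set_biInter_insert,
      ← ih fun i hi => hE i (Finset.mem_insert_of_mem hi)]
    have hd : Disjoint (S k) (⋃ j ∈ s, S j) := by
      rw [Set.disjoint_iUnion₂_right]
      intro j hj
      exact hS (fun e => hk (e ▸ hj))
    refine (Indep_iff _ _ μ).1 (indep_iSup_of_disjoint h_le h hd) _ _
      (hE k (Finset.mem_insert_self k s)) ?_
    refine Finset.measurableSet_biInter _ fun j hj => ?_
    have hle : (⨆ i ∈ S j, m i) ≤ ⨆ i ∈ ⋃ j ∈ s, S j, m i :=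
      biSup_mono fun i hi => Set.mem_biUnion hj hi
    exact hle _ (hE j (Finset.mem_insert_of_mem hj))

variable {β : ι → Type*} [mβ : ∀ i, MeasurableSpace (β i)] {f : ∀ i, Ω → β i}

theorem measurable_iSup_comap {S : Set ι} {i : ι} (hi : i ∈ S) :
    Measurable[⨆ i ∈ S, (mβ i).comap (f i)] (f i) :=
  (comap_measurable (f i)).mono (le_biSup (fun i => (mβ i).comap (f i)) hi) le_rfl

theorem iIndepFun_of_measurable_iSup [MeasurableSpace Ω] {μ : Measure Ω} [IsProbabilityMeasure μ]
    {γ : κ → Type*}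
    [mγ : ∀ k, MeasurableSpace (γ k)] (hf : ∀ i, Measurable (f i)) (h : iIndepFun f μ)
    {S : κ → Set ι} (hS : Pairwise (Function.onFun Disjoint S)) {g : ∀ k, Ω → γ k}
    (hg : ∀ k, Measurable[⨆ i ∈ S k, (mβ i).comap (f i)] (g k)) : iIndepFun g μ := by
  have h1 := iIndep_iSup_of_pairwise_disjoint (fun i => (hf i).comap_le) h.iIndep hS
  rw [iIndepFun_iff_iIndep, iIndep_iff]
  rw [iIndep_iff] at h1
  intro s E hE
  exact h1 s fun i hi => (hg i).comap_le _ (hE i hi)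

theorem indepFun_of_measurable_iSup [MeasurableSpace Ω] {μ : Measure Ω} {γ δ : Type*}
    [mγ : MeasurableSpace γ] [mδ : MeasurableSpace δ]
    (hf : ∀ i, Measurable (f i)) (h : iIndepFun f μ) {S T : Set ι} (hST : Disjoint S T)
    {g : Ω → γ} {k : Ω → δ} (hg : Measurable[⨆ i ∈ S, (mβ i).comap (f i)] g)
    (hk : Measurable[⨆ i ∈ T, (mβ i).comap (f i)] k) : IndepFun g k μ :=
  indep_of_indep_of_le_left (indep_of_indep_of_le_right
    (indep_iSup_of_disjoint (fun i => (hf i).comap_le) h.iIndep hST) hk.comap_le) hg.comap_le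

end Independence

/-! ### Selection within one window -/

section Window

variable {Ω : Type*} [MeasurableSpace Ω] {μ : Measure Ω}

theorem measure_le_of_map_eq_maxLaw {M : ℕ} (hM : M ≠ 0) {s : ℝ} (hs : 0 < s) {Z : Ω → ℝ}
    (hZ : Measurable Z) (h : μ.map Z = maxLaw M s) {y : ℝ} (hy : 0 ≤ y) :
    μ {ω | Z ω ≤ y} = ENNReal.ofReal (maxCDF M s y) := by
  rw [← maxLaw_Iic hM hs hy, ← h, Measure.map_apply hZ measurableSet_Iic]
  rfl

theorem measure_lt_of_map_eq_maxLaw [IsProbabilityMeasure μ] {M : ℕ} (hM : M ≠ 0) {s : ℝ}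
    (hs : 0 < s) {Z : Ω → ℝ}
    (hZ : Measurable Z) (h : μ.map Z = maxLaw M s) {y : ℝ} (hy : 0 ≤ y) :
    μ {ω | y < Z ω} = ENNReal.ofReal (1 - maxCDF M s y) := by
  have h1 : {ω | y < Z ω} = {ω | Z ω ≤ y}ᶜ := by ext; simp
  rw [h1, prob_compl_eq_one_sub (measurableSet_le hZ measurable_const),
    measure_le_of_map_eq_maxLaw hM hs hZ h hy, ENNReal.ofReal_sub _ (maxCDF_nonneg M hs hy),
    ENNReal.ofReal_one]

theorem measure_eq_const_of_map_eq_maxLaw {M : ℕ} {s : ℝ} {Z : Ω → ℝ}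
    (hZ : Measurable Z) (h : μ.map Z = maxLaw M s) (c : ℝ) : μ {ω | Z ω = c} = 0 := by
  have : μ.map Z {c} = 0 := by rw [h]; exact measure_singleton c
  rwa [Measure.map_apply hZ (measurableSet_singleton c)] at this

theorem measure_min_le [IsProbabilityMeasure μ] {N : ℕ} (hN : N ≠ 0) {s : ℝ} (hs : 0 < s)
    {X V : Ω → ℝ} (hX : Measurable X)
    (hV : Measurable V) (hXV : IndepFun X V μ) (lX : μ.map X = maxLaw 1 s)
    (lV : μ.map V = maxLaw N s) {y : ℝ} (hy : 0 ≤ y) :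
    μ {ω | min (X ω) (V ω) ≤ y} = ENNReal.ofReal (pathCDF N s y) := by
  have h1 : {ω | min (X ω) (V ω) ≤ y} = ({ω | y < X ω} ∩ {ω | y < V ω})ᶜ := by
    ext ω
    simp [or_iff_not_imp_left]
  have hmX := measurableSet_lt (measurable_const (a := y)) hX
  have hmV := measurableSet_lt (measurable_const (a := y)) hV
  have h2 : μ ({ω | y < X ω} ∩ {ω | y < V ω}) = μ {ω | y < X ω} * μ {ω | y < V ω} :=
    hXV.measure_inter_preimage_eq_mul _ _ measurableSet_Ioi measurableSet_Ioi
  have e1 : 1 - maxCDF 1 s y = Real.exp (-y / s) := by simp [maxCDF]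
  rw [h1, prob_compl_eq_one_sub (hmX.inter hmV), h2,
    measure_lt_of_map_eq_maxLaw one_ne_zero hs hX lX hy, measure_lt_of_map_eq_maxLaw hN hs hV lV hy,
    e1, ← ENNReal.ofReal_mul (Real.exp_pos _).le, ← ENNReal.ofReal_one,
    ← ENNReal.ofReal_sub _ (mul_nonneg (Real.exp_pos _).le
      (sub_nonneg.2 (maxCDF_le_one N hs hy)))]
  rfl

variable {κ : Type*}

/-- The rates of the best paths through different relays are independent. -/
theorem iIndepFun_min [IsProbabilityMeasure μ] {X V : κ → Ω → ℝ} (hX : ∀ k, Measurable (X k))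
    (hV : ∀ k, Measurable (V k))
    (hind : iIndepFun (Sum.elim X V) μ) : iIndepFun (fun k ω => min (X k ω) (V k ω)) μ := by
  have hm : ∀ q, Measurable (Sum.elim X V q) := by rintro (k | k); exacts [hX k, hV k]
  refine iIndepFun_of_measurable_iSup hm hind
    (S := fun k => {Sum.inl k, Sum.inr k}) ?_ fun k => ?_
  · intro k l hkl
    simp [Function.onFun, hkl.symm]
  · exact (measurable_iSup_comap (f := Sum.elim X V) (i := Sum.inl k) (by simp)).min
      (measurable_iSup_comap (f := Sum.elim X V) (i := Sum.inr k) (by simp))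

theorem measure_forall_min_le [IsProbabilityMeasure μ] [Fintype κ] {N : ℕ} (hN : N ≠ 0) {s : ℝ}
    (hs : 0 < s) {X V : κ → Ω → ℝ}
    (hX : ∀ k, Measurable (X k)) (hV : ∀ k, Measurable (V k))
    (hind : iIndepFun (Sum.elim X V) μ) (lX : ∀ k, μ.map (X k) = maxLaw 1 s)
    (lV : ∀ k, μ.map (V k) = maxLaw N s) {y : ℝ} (hy : 0 ≤ y) :
    μ {ω | ∀ k, min (X k ω) (V k ω) ≤ y} =
      ENNReal.ofReal (pathCDF N s y ^ Fintype.card κ) := by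
  have h1 : {ω | ∀ k, min (X k ω) (V k ω) ≤ y} =
      ⋂ k, (fun ω => min (X k ω) (V k ω)) ⁻¹' Set.Iic y := by ext; simp
  rw [h1, (iIndepFun_min hX hV hind).meas_iInter fun k => ⟨_, measurableSet_Iic, rfl⟩]
  have h2 : ∀ k, μ ((fun ω => min (X k ω) (V k ω)) ⁻¹' Set.Iic y) =
      ENNReal.ofReal (pathCDF N s y) := fun k =>
    measure_min_le hN hs (hX k) (hV k)
      (hind.indepFun (i := Sum.inl k) (j := Sum.inr k) (by simp)) (lX k) (lV k) hy
  simp only [h2, Finset.prod_const, Finset.card_univ]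
  rw [ENNReal.ofReal_pow (pathCDF_nonneg N hs hy)]

theorem measure_forall_min_lt [IsProbabilityMeasure μ] [Fintype κ] [DecidableEq κ] {N : ℕ}
    (hN : N ≠ 0) {s : ℝ} (hs : 0 < s) {X V : κ → Ω → ℝ}
    (hX : ∀ k, Measurable (X k)) (hV : ∀ k, Measurable (V k))
    (hind : iIndepFun (Sum.elim X V) μ) (lX : ∀ k, μ.map (X k) = maxLaw 1 s)
    (lV : ∀ k, μ.map (V k) = maxLaw N s) (k : κ) {y : ℝ} (hy : 0 ≤ y) :
    μ {ω | ∀ l : {l // l ≠ k}, min (X l ω) (V l ω) < y} =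
      ENNReal.ofReal (pathCDF N s y ^ (Fintype.card κ - 1)) := by
  have h0 : iIndepFun (Sum.elim (fun l : {l // l ≠ k} => X l) (fun l : {l // l ≠ k} => V l)) μ := by
    have := hind.precomp (g := Sum.map (Subtype.val : {l // l ≠ k} → κ)
      (Subtype.val : {l // l ≠ k} → κ))
      (Sum.map_injective.2 ⟨Subtype.val_injective, Subtype.val_injective⟩)
    convert! this using 1
    ext q
    rcases q with q | q <;> rfl
  have h1 := measure_forall_min_le hN hs (fun l : {l // l ≠ k} => hX l)
    (fun l : {l // l ≠ k} => hV l) h0 (fun l => lX l) (fun l => lV l) hy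
  rw [Fintype.card_subtype_compl, Fintype.card_subtype_eq] at h1
  rw [← h1]
  refine measure_congr ?_
  -- The laws have no atoms, so strict and weak inequalities define the same event up to a null set.
  have h2 : ∀ᵐ ω ∂μ, ∀ l, X l ω ≠ y ∧ V l ω ≠ y := by
    rw [ae_all_iff]
    intro l
    rw [Filter.eventually_and]
    exact ⟨by simpa [ae_iff] using measure_eq_const_of_map_eq_maxLaw (hX l) (lX l) y,
      by simpa [ae_iff] using measure_eq_const_of_map_eq_maxLaw (hV l) (lV l) y⟩
  filter_upwards [h2] with ω hω
  refine propext ⟨fun h l => (h l).le, fun h l => lt_of_le_of_ne (h l) ?_⟩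
  rcases min_choice (X l ω) (V l ω) with e | e <;> rw [e]
  exacts [(hω l).1, (hω l).2]

/-- `V k` is independent of the path SNRs of the other relays, so Fubini conditions on `V k = v`;
the others lie below `v` with probability `pathCDF N s v ^ (card κ - 1)`. -/
theorem measure_second_hop_bottleneck [IsProbabilityMeasure μ] [Fintype κ] [DecidableEq κ] {N : ℕ}
    (hN : N ≠ 0) {s : ℝ} (hs : 0 < s) {X V : κ → Ω → ℝ}
    (hX : ∀ k, Measurable (X k)) (hV : ∀ k, Measurable (V k))
    (hind : iIndepFun (Sum.elim X V) μ) (lX : ∀ k, μ.map (X k) = maxLaw 1 s)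
    (lV : ∀ k, μ.map (V k) = maxLaw N s) (k : κ) {x : ℝ} (hx : 0 ≤ x) :
    μ {ω | V k ω ≤ x ∧ ∀ l : {l // l ≠ k}, min (X l ω) (V l ω) < V k ω} =
      ENNReal.ofReal (∫ v in (0 : ℝ)..x, maxPDF N s v * pathCDF N s v ^ (Fintype.card κ - 1)) := by
  have hm : ∀ q, Measurable (Sum.elim X V q) := by rintro (k | k); exacts [hX k, hV k]
  let R : Ω → {l // l ≠ k} → ℝ := fun ω l => min (X l ω) (V l ω)
  have hR : Measurable R := measurable_pi_iff.2 fun l => (hX l).min (hV l)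
  have hVR : IndepFun (V k) R μ := by
    refine indepFun_of_measurable_iSup hm hind (S := {Sum.inr k}) (T := {Sum.inr k}ᶜ)
      disjoint_compl_right
      (measurable_iSup_comap (f := Sum.elim X V) (i := Sum.inr k) (by simp)) ?_
    refine (@measurable_pi_iff Ω {l // l ≠ k} (fun _ => ℝ) (_) _ R).2 fun l => ?_
    exact (measurable_iSup_comap (f := Sum.elim X V) (i := Sum.inl l.1) (by simp)).min
      (measurable_iSup_comap (f := Sum.elim X V) (i := Sum.inr l.1) (by simp [l.2]))
  let D : Set (ℝ × ({l // l ≠ k} → ℝ)) := {p | p.1 ≤ x ∧ ∀ l, p.2 l < p.1}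
  have hD : MeasurableSet D := by
    have : D = {p | p.1 ≤ x} ∩ ⋂ l, {p | p.2 l < p.1} := by ext; simp [D]
    rw [this]
    exact (measurableSet_le (by fun_prop) (by fun_prop)).inter
      (MeasurableSet.iInter fun l => measurableSet_lt (by fun_prop) (by fun_prop))
  have := Measure.isProbabilityMeasure_map (hR.aemeasurable (μ := μ))
  have h1 : {ω | V k ω ≤ x ∧ ∀ l : {l // l ≠ k}, min (X l ω) (V l ω) < V k ω} =
      (fun ω => (V k ω, R ω)) ⁻¹' D := rfl
  rw [h1, ← Measure.map_apply ((hV k).prodMk hR) hD,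
    hVR.map_prod_eq_prod_map_map (hV k).aemeasurable hR.aemeasurable, lV k,
    Measure.prod_apply hD]
  have hc := continuous_pathCDF N s
  rw [← setLIntegral_maxLaw N hs (φ := fun v => pathCDF N s v ^ (Fintype.card κ - 1)) (by fun_prop)
    (fun v hv => pow_nonneg (pathCDF_nonneg N hs hv) _) hx, ← lintegral_indicator measurableSet_Iic]
  -- The formula for the conditional probability is available for nonnegative thresholds only.
  have hpos : ∀ᵐ v ∂(maxLaw N s), 0 < v := by
    have h2 : ∀ᵐ v ∂(volume.restrict (Set.Ioi (0 : ℝ))), 0 < v := ae_restrict_mem measurableSet_Ioi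
    exact (withDensity_absolutelyContinuous _ _).ae_le h2
  refine lintegral_congr_ae ?_
  filter_upwards [hpos] with v hv
  by_cases hvx : v ≤ x
  · rw [Set.indicator_of_mem (Set.mem_Iic.2 hvx),
    ← measure_forall_min_lt hN hs hX hV hind lX lV k hv.le,
      Measure.map_apply hR (measurable_prodMk_left hD)]
    congr 1
    ext ω
    simp [D, R, hvx]
  · rw [Set.indicator_of_notMem (by simpa using hvx)]
    have : Prod.mk v ⁻¹' D = ∅ := by ext u; simp [D, hvx]
    rw [this, measure_empty]

/-- The first hop of the strictly best path through relay `k` has SNR above `x`. -/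
def selectedAbove (X V : κ → Ω → ℝ) (x : ℝ) (k : κ) : Set Ω :=
  {ω | (∀ l, l ≠ k → min (X l ω) (V l ω) < min (X k ω) (V k ω)) ∧ x < X k ω}

theorem measurableSet_selectedAbove [Fintype κ] {Ω : Type*} {mΩ : MeasurableSpace Ω}
    {X V : κ → Ω → ℝ}
    (hX : ∀ k, Measurable (X k)) (hV : ∀ k, Measurable (V k)) (x : ℝ) (k : κ) :
    MeasurableSet (selectedAbove X V x k) := by
  have : selectedAbove X V x k = (⋂ l, ⋂ (_ : l ≠ k),
      {ω | min (X l ω) (V l ω) < min (X k ω) (V k ω)}) ∩ {ω | x < X k ω} := by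
    ext; simp [selectedAbove]
  rw [this]
  exact (MeasurableSet.iInter fun l => MeasurableSet.iInter fun _ =>
    measurableSet_lt ((hX l).min (hV l)) ((hX k).min (hV k))).inter
      (measurableSet_lt measurable_const (hX k))

theorem pairwise_disjoint_selectedAbove {Ω : Type*} (X V : κ → Ω → ℝ) (x : ℝ) :
    Pairwise (Function.onFun Disjoint (selectedAbove X V x)) := by
  intro k l hkl
  refine Set.disjoint_left.2 fun ω h1 h2 => ?_
  exact lt_asymm (h1.1 l hkl.symm) (h2.1 k hkl)

/-- The event splits into `Bᶜ`, where some path exceeds `x` and the best one therefore has first hop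
above `x`, and the events `E k`, where the best path is limited to at most `x` by its second hop. In
`E k` the condition on `X k` is independent of the rest, whence the factor `e^{-x/s}`. -/
theorem sum_measure_selectedAbove [IsProbabilityMeasure μ] [Fintype κ] [Nonempty κ] {s : ℝ}
    (hs : 0 < s) {X V : κ → Ω → ℝ}
    (hX : ∀ k, Measurable (X k)) (hV : ∀ k, Measurable (V k))
    (hind : iIndepFun (Sum.elim X V) μ) (lX : ∀ k, μ.map (X k) = maxLaw 1 s)
    (lV : ∀ k, μ.map (V k) = maxLaw (Fintype.card κ) s)
    (htie : ∀ᵐ ω ∂μ, ∀ k l, k ≠ l → min (X k ω) (V k ω) ≠ min (X l ω) (V l ω))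
    {x : ℝ} (hx : 0 ≤ x) :
    ∑ k, μ (selectedAbove X V x k) = ENNReal.ofReal (windowTail (Fintype.card κ) s x) := by
  classical
  have hm : ∀ q, Measurable (Sum.elim X V q) := by rintro (k | k); exacts [hX k, hV k]
  obtain ⟨m, hcard⟩ : ∃ m, Fintype.card κ = m + 1 :=
    ⟨Fintype.card κ - 1, by have := Fintype.card_pos (α := κ); omega⟩
  have hcard0 : Fintype.card κ ≠ 0 := Fintype.card_ne_zero
  let E : κ → Set Ω := fun k =>
    {ω | x < X k ω} ∩ {ω | V k ω ≤ x ∧ ∀ l : {l // l ≠ k}, min (X l ω) (V l ω) < V k ω}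
  let B : Set Ω := {ω | ∀ k, min (X k ω) (V k ω) ≤ x}
  have hEmeas' : ∀ (m' : MeasurableSpace Ω) (k : κ), Measurable[m'] (V k) →
      (∀ l : {l // l ≠ k}, Measurable[m'] fun ω => min (X l ω) (V l ω)) →
      MeasurableSet[m'] {ω | V k ω ≤ x ∧ ∀ l : {l // l ≠ k}, min (X l ω) (V l ω) < V k ω} := by
    intro m' k h1 h2
    have : {ω | V k ω ≤ x ∧ ∀ l : {l // l ≠ k}, min (X l ω) (V l ω) < V k ω} =
      {ω | V k ω ≤ x} ∩ ⋂ l : {l // l ≠ k}, {ω | min (X l ω) (V l ω) < V k ω} := by ext; simp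
    rw [this]
    exact (measurableSet_le h1 measurable_const).inter
      (MeasurableSet.iInter fun l => measurableSet_lt (h2 l) h1)
  have hEmeas : ∀ k, MeasurableSet (E k) := fun k =>
    (measurableSet_lt measurable_const (hX k)).inter
      (hEmeas' _ k (hV k) fun l => (hX l).min (hV l))
  have hB : MeasurableSet B := by
    have : B = ⋂ k, {ω | min (X k ω) (V k ω) ≤ x} := by ext; simp [B]
    rw [this]
    exact MeasurableSet.iInter fun k => measurableSet_le ((hX k).min (hV k)) measurable_const
  have hE : ∀ k, μ (E k) = ENNReal.ofReal (Real.exp (-x / s) *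
      ∫ v in (0 : ℝ)..x, maxPDF (m + 1) s v * pathCDF (m + 1) s v ^ m) := by
    intro k
    have hi := (Indep_iff _ _ μ).1 (indep_iSup_of_disjoint (fun i => (hm i).comap_le) hind.iIndep
      (S := {Sum.inl k}) (T := {Sum.inl k}ᶜ) disjoint_compl_right) {ω | x < X k ω}
      {ω | V k ω ≤ x ∧ ∀ l : {l // l ≠ k}, min (X l ω) (V l ω) < V k ω}
      (measurableSet_lt measurable_const
        (measurable_iSup_comap (f := Sum.elim X V) (i := Sum.inl k) (by simp)))
      (hEmeas' _ k (measurable_iSup_comap (f := Sum.elim X V) (i := Sum.inr k) (by simp))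
        fun l => (measurable_iSup_comap (f := Sum.elim X V) (i := Sum.inl l.1) (by simp [l.2])).min
          (measurable_iSup_comap (f := Sum.elim X V) (i := Sum.inr l.1) (by simp)))
    have e1 : 1 - maxCDF 1 s x = Real.exp (-x / s) := by simp [maxCDF]
    rw [hi, measure_lt_of_map_eq_maxLaw one_ne_zero hs (hX k) (lX k) hx, e1,
      measure_second_hop_bottleneck hcard0 hs hX hV hind lX lV k hx,
      ← ENNReal.ofReal_mul (Real.exp_pos _).le, hcard, Nat.add_sub_cancel]
  -- Absence of ties is needed only to make a maximizer on `Bᶜ` a strict one.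
  have hunion : (⋃ k, selectedAbove X V x k : Set Ω) =ᵐ[μ] (Bᶜ ∪ ⋃ k, E k : Set Ω) := by
    filter_upwards [htie] with ω hω
    refine propext ⟨fun h => ?_, fun h => ?_⟩
    · obtain ⟨k, hk, hxk⟩ := Set.mem_iUnion.1 h
      by_cases hb : ω ∈ B
      · right
        have hVk : V k ω ≤ x := by
          rcases min_le_iff.1 (hb k) with h | h
          · exact absurd hxk h.not_gt
          · exact h
        refine Set.mem_iUnion.2 ⟨k, hxk, hVk, fun l => ?_⟩
        have := hk l l.2
        rwa [min_eq_right (hVk.trans hxk.le)] at this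
      · exact Or.inl hb
    · rcases h with h | h
      · obtain ⟨k0, hk0⟩ : ∃ k0, x < min (X k0 ω) (V k0 ω) := by
          by_contra hcon
          push Not at hcon
          exact h hcon
        obtain ⟨k, hk⟩ := Finite.exists_max fun k => min (X k ω) (V k ω)
        refine Set.mem_iUnion.2 ⟨k, fun l hl => lt_of_le_of_ne (hk l) (hω l k hl), ?_⟩
        exact hk0.trans_le ((hk k0).trans (min_le_left _ _))
      · obtain ⟨k, hxk, hVk, hk⟩ := Set.mem_iUnion.1 h
        refine Set.mem_iUnion.2 ⟨k, fun l hl => ?_, hxk⟩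
        rw [min_eq_right (hVk.trans (le_of_lt hxk))]
        exact hk ⟨l, hl⟩
  have hdisjE : Pairwise (Function.onFun Disjoint E) := by
    intro k l hkl
    refine Set.disjoint_left.2 fun ω h1 h2 => ?_
    have a := h1.2.2 ⟨l, hkl.symm⟩
    have b := h2.2.2 ⟨k, hkl⟩
    simp only at a b
    rw [min_eq_right (h2.2.1.trans (le_of_lt h2.1))] at a
    rw [min_eq_right (h1.2.1.trans (le_of_lt h1.1))] at b
    exact lt_asymm a b
  have hdisjB : Disjoint Bᶜ (⋃ k, E k) := by
    rw [Set.disjoint_iUnion_right]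
    intro k
    refine Set.disjoint_left.2 fun ω h1 h2 => h1 fun l => ?_
    by_cases hl : l = k
    · exact (min_le_right _ _).trans (hl ▸ h2.2.1)
    · exact (h2.2.2 ⟨l, hl⟩).le.trans h2.2.1
  have hI := integral_maxPDF_mul_pathCDF_nonneg (m + 1) m hs hx
  have hp1 := pathCDF_le_one (m + 1) hs hx
  have hp0 := pathCDF_nonneg (m + 1) hs hx
  calc ∑ k, μ (selectedAbove X V x k) = μ (⋃ k, selectedAbove X V x k) := by
        rw [measure_iUnion (pairwise_disjoint_selectedAbove X V x)
          (fun k => measurableSet_selectedAbove hX hV x k), tsum_fintype]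
    _ = μ Bᶜ + ∑ k, μ (E k) := by
        rw [measure_congr hunion, measure_union hdisjB (MeasurableSet.iUnion hEmeas),
          measure_iUnion hdisjE hEmeas, tsum_fintype]
    _ = _ := by
        rw [prob_compl_eq_one_sub hB, measure_forall_min_le hcard0 hs hX hV hind lX lV hx]
        simp only [hE, Finset.sum_const, Finset.card_univ, hcard, nsmul_eq_mul]
        rw [windowTail_eq m hs.ne', ENNReal.ofReal_add (sub_nonneg.2 (pow_le_one₀ hp0 hp1))
          (by positivity), ENNReal.ofReal_sub _ (pow_nonneg hp0 _), ENNReal.ofReal_one, mul_assoc,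
          ENNReal.ofReal_mul (by positivity : (0 : ℝ) ≤ (m : ℝ) + 1)]
        congr 2
        rw [← ENNReal.ofReal_natCast]
        push_cast
        rfl

end Window

/-! ### From channel coefficients to the variables of a window -/

section Channels

variable {Ω : Type*} {M : ℕ} {P noise : ℝ} {h : WindowChannels Ω M}

theorem snr_nonneg (hP : 0 < P) (hn : 0 < noise) (t : ℕ) (c : Fin 2) (i j : Fin M) (ω : Ω) :
    0 ≤ snr P noise h t c i j ω := by
  unfold snr; positivity

/-- SNR of the best link from relay `k` in the second hop of window `t`. -/
noncomputable def bestSecondHop [NeZero M] (P noise : ℝ) (h : WindowChannels Ω M) (t : ℕ)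
    (k : Fin M) (ω : Ω) : ℝ :=
  Finset.univ.sup' Finset.univ_nonempty fun j => snr P noise h t 1 k j ω

theorem bestSecondHop_le_iff [NeZero M] {t : ℕ} {k : Fin M} {ω : Ω} {y : ℝ} :
    bestSecondHop P noise h t k ω ≤ y ↔ ∀ j, snr P noise h t 1 k j ω ≤ y := by
  rw [bestSecondHop, Finset.sup'_le_iff]
  simp

theorem snr_le_bestSecondHop [NeZero M] (t : ℕ) (k j : Fin M) (ω : Ω) :
    snr P noise h t 1 k j ω ≤ bestSecondHop P noise h t k ω :=
  bestSecondHop_le_iff.1 le_rfl j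

theorem exists_bestSecondHop_eq [NeZero M] (t : ℕ) (k : Fin M) (ω : Ω) :
    ∃ j, bestSecondHop P noise h t k ω = snr P noise h t 1 k j ω := by
  obtain ⟨j, _, hj⟩ := Finset.exists_mem_eq_sup' (Finset.univ_nonempty :
    (Finset.univ : Finset (Fin M)).Nonempty) fun j => snr P noise h t 1 k j ω
  exact ⟨j, hj⟩

theorem windowRate_le_iff (hP : 0 < P) (hn : 0 < noise) {t : ℕ} {i k j k' j' : Fin M} {ω : Ω} :
    windowRate P noise h t i k' j' ω ≤ windowRate P noise h t i k j ω ↔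
      min (snr P noise h t 0 i k' ω) (snr P noise h t 1 k' j' ω) ≤
        min (snr P noise h t 0 i k ω) (snr P noise h t 1 k j ω) := by
  have hpos : ∀ k j, 0 < 1 + min (snr P noise h t 0 i k ω) (snr P noise h t 1 k j ω) := fun k j =>
    add_pos_of_pos_of_nonneg one_pos (le_min (snr_nonneg hP hn _ _ _ _ _)
      (snr_nonneg hP hn _ _ _ _ _))
  rw [windowRate, windowRate, Real.logb_le_logb one_lt_two (hpos _ _) (hpos _ _),
    add_le_add_iff_left]

theorem lt_endToEndSNR_iff [NeZero M] {T : ℕ} {r : ℕ → Ω → Fin M} {x : ℝ} {ω : Ω} :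
    x < endToEndSNR T P noise h r ω ↔ ∀ l, 1 ≤ l → l ≤ T + 1 → x < hopSNR T P noise h r l ω := by
  constructor
  · intro hx l h1 h2
    have := ciInf_le (Set.finite_range fun l : Fin (T + 1) =>
      hopSNR T P noise h r (l + 1) ω).bddBelow ⟨l - 1, by omega⟩
    simp only [Nat.sub_add_cancel h1] at this
    exact hx.trans_le this
  · intro hx
    obtain ⟨l, hl⟩ := exists_eq_ciInf_of_finite
      (f := fun l : Fin (T + 1) => hopSNR T P noise h r (l + 1) ω)
    rw [endToEndSNR, ← hl]
    exact hx _ (by omega) (by omega)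

theorem endToEndSNR_nonneg [NeZero M] (hP : 0 < P) (hn : 0 < noise) (T : ℕ) (r : ℕ → Ω → Fin M)
    (ω : Ω) : 0 ≤ endToEndSNR T P noise h r ω := by
  refine le_ciInf fun l => ?_
  unfold hopSNR
  split_ifs <;> exact snr_nonneg hP hn _ _ _ _ _

/-- SNR of a link, the links of all windows being indexed by a single type. -/
noncomputable def linkSNR (T : ℕ) (P noise : ℝ) (h : WindowChannels Ω M)
    (q : Finset.Icc 1 T × Fin 2 × Fin M × Fin M) (ω : Ω) : ℝ :=
  snr P noise h q.1 q.2.1 q.2.2.1 q.2.2.2 ω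

/-- Each minimum is the SNR of an actual link, one incident to `k` and the other to `l`; these links
are distinct in all four cases. -/
theorem min_ne_of_linkSNR_injective [NeZero M] {T : ℕ} {ω : Ω}
    (hinj : Function.Injective fun q => linkSNR T P noise h q ω) {t : ℕ} (ht : t ∈ Finset.Icc 1 T)
    (i : Fin M) {k l : Fin M} (hkl : k ≠ l) :
    min (snr P noise h t 0 i k ω) (bestSecondHop P noise h t k ω) ≠
      min (snr P noise h t 0 i l ω) (bestSecondHop P noise h t l ω) := by
  obtain ⟨j, hj⟩ := exists_bestSecondHop_eq (P := P) (noise := noise) (h := h) t k ω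
  obtain ⟨j', hj'⟩ := exists_bestSecondHop_eq (P := P) (noise := noise) (h := h) t l ω
  intro he
  have key : ∀ c a b c' a' b', snr P noise h t c a b ω = snr P noise h t c' a' b' ω →
      c = c' ∧ a = a' ∧ b = b' := by
    intro c a b c' a' b' he
    simpa using @hinj (⟨t, ht⟩, c, a, b) (⟨t, ht⟩, c', a', b') he
  rw [hj, hj'] at he
  rcases min_choice (snr P noise h t 0 i k ω) (snr P noise h t 1 k j ω) with e | e <;>
  rcases min_choice (snr P noise h t 0 i l ω) (snr P noise h t 1 l j' ω) with e' | e' <;>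
  rw [e, e'] at he <;> have := key _ _ _ _ _ _ he <;> simp_all

theorem measurable_bestSecondHop [NeZero M] {m' : MeasurableSpace Ω} {t : ℕ} {k : Fin M}
    (hm : ∀ j, Measurable[m'] (snr P noise h t 1 k j)) :
    Measurable[m'] (bestSecondHop P noise h t k) := by
  have := Finset.measurable_sup' (Finset.univ_nonempty :
    (Finset.univ : Finset (Fin M)).Nonempty) fun j _ => hm j
  convert! this using 1
  ext ω
  rw [Finset.sup'_apply]
  rfl

variable [MeasurableSpace Ω] {μ : Measure Ω} {T : ℕ} {v : ℝ}

theorem measurable_linkSNR (hh : IsIndependentWindowModel μ T v h)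
    (q : Finset.Icc 1 T × Fin 2 × Fin M × Fin M) : Measurable (linkSNR T P noise h q) := by
  have := hh.measurable q.1 q.1.2 q.2.1 q.2.2.1 q.2.2.2
  unfold linkSNR snr
  fun_prop

theorem iIndepFun_linkSNR (hh : IsIndependentWindowModel μ T v h) :
    iIndepFun (linkSNR T P noise h) μ :=
  hh.indep.comp (fun _ z => P / noise * ‖z‖ ^ 2) fun _ => by fun_prop

theorem map_linkSNR [IsProbabilityMeasure μ] (hP : 0 < P) (hn : 0 < noise) (hv : 0 < v)
    (hh : IsIndependentWindowModel μ T v h) (q : Finset.Icc 1 T × Fin 2 × Fin M × Fin M) :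
    μ.map (linkSNR T P noise h q) = maxLaw 1 (P * v / noise) := by
  have hm := measurable_linkSNR (P := P) (noise := noise) hh q
  have hs : 0 < P * v / noise := by positivity
  refine map_eq_maxLaw one_ne_zero hs hm (fun ω => snr_nonneg hP hn _ _ _ _ _) fun y hy => ?_
  have h1 : {ω | linkSNR T P noise h q ω ≤ y} = {ω | y < linkSNR T P noise h q ω}ᶜ := by
    ext; simp
  have h2 : {ω | y < linkSNR T P noise h q ω} =
      h q.1 q.2.1 q.2.2.1 q.2.2.2 ⁻¹' {z | y * noise / P < ‖z‖ ^ 2} := by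
    ext ω
    simp only [linkSNR, snr, Set.mem_ofPred_eq, Set.mem_preimage]
    rw [div_lt_iff₀ hP, div_mul_eq_mul_div, lt_div_iff₀ hn, mul_comm P]
  have h3 : μ {ω | y < linkSNR T P noise h q ω} =
      ENNReal.ofReal (Real.exp (-y / (P * v / noise))) := by
    rw [h2, ← Measure.map_apply (hh.measurable q.1 q.1.2 _ _ _)
      (measurableSet_lt measurable_const (by fun_prop)), hh.law q.1 q.1.2,
      rayleighFading_lt_norm_sq hv (by positivity)]
    congr 2
    field_simp
  rw [h1, prob_compl_eq_one_sub (measurableSet_lt measurable_const hm), h3, ← ENNReal.ofReal_one,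
    ← ENNReal.ofReal_sub _ (Real.exp_pos _).le]
  simp [maxCDF]

theorem ae_ne_of_indepFun [IsProbabilityMeasure μ] {X Y : Ω → ℝ} (hX : Measurable X)
    (hY : Measurable Y) (hXY : IndepFun X Y μ) [NullSingletonClass (μ.map Y)] :
    ∀ᵐ ω ∂μ, X ω ≠ Y ω := by
  have h1 := hXY.map_prod_eq_prod_map_map hX.aemeasurable hY.aemeasurable
  have := Measure.isProbabilityMeasure_map (hX.aemeasurable (μ := μ))
  have := Measure.isProbabilityMeasure_map (hY.aemeasurable (μ := μ))
  have hD : MeasurableSet {p : ℝ × ℝ | p.1 = p.2} :=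
    measurableSet_eq_fun measurable_fst measurable_snd
  have h2 : μ {ω | X ω = Y ω} = ((μ.map X).prod (μ.map Y)) {p | p.1 = p.2} := by
    rw [← h1, Measure.map_apply (hX.prodMk hY) hD]
    rfl
  rw [ae_iff]
  simp only [ne_eq, not_not]
  rw [h2, Measure.prod_apply hD]
  have h3 : ∀ x : ℝ, Prod.mk x ⁻¹' {p : ℝ × ℝ | p.1 = p.2} = {x} := by
    intro x; ext y; simp [eq_comm]
  simp [h3]

theorem ae_linkSNR_injective [IsProbabilityMeasure μ] (hP : 0 < P) (hn : 0 < noise) (hv : 0 < v)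
    (hh : IsIndependentWindowModel μ T v h) :
    ∀ᵐ ω ∂μ, Function.Injective fun q => linkSNR T P noise h q ω := by
  have h1 : ∀ᵐ ω ∂μ, ∀ q q', q ≠ q' → linkSNR T P noise h q ω ≠ linkSNR T P noise h q' ω := by
    rw [ae_all_iff]
    intro q
    rw [ae_all_iff]
    intro q'
    by_cases hq : q = q'
    · exact ae_of_all _ fun ω hne => absurd hq hne
    · have : NullSingletonClass (μ.map (linkSNR T P noise h q')) := by
        rw [map_linkSNR hP hn hv hh]; infer_instance
      filter_upwards [ae_ne_of_indepFun (measurable_linkSNR (P := P) (noise := noise) hh q)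
        (measurable_linkSNR hh q')
        ((iIndepFun_linkSNR hh).indepFun hq)] with ω hω _ using hω
  filter_upwards [h1] with ω hω q q' hqq
  by_contra hne
  exact hω q q' hne hqq

variable [NeZero M]

theorem map_bestSecondHop [IsProbabilityMeasure μ] (hP : 0 < P) (hn : 0 < noise) (hv : 0 < v)
    (hh : IsIndependentWindowModel μ T v h) {t : ℕ} (ht : t ∈ Finset.Icc 1 T) (k : Fin M) :
    μ.map (bestSecondHop P noise h t k) = maxLaw M (P * v / noise) := by
  have hm : ∀ j, Measurable (snr P noise h t 1 k j) := fun j =>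
    measurable_linkSNR hh (⟨t, ht⟩, 1, k, j)
  have hs : 0 < P * v / noise := by positivity
  refine map_eq_maxLaw (NeZero.ne M) hs (measurable_bestSecondHop hm)
    (fun ω => (snr_nonneg hP hn t 1 k 0 ω).trans (snr_le_bestSecondHop t k 0 ω)) fun y hy => ?_
  have hind : iIndepFun (fun j => snr P noise h t 1 k j) μ :=
    (iIndepFun_linkSNR hh).precomp (g := fun j => ((⟨t, ht⟩, 1, k, j) :
      Finset.Icc 1 T × Fin 2 × Fin M × Fin M)) fun j j' hj => by simpa using hj
  have h1 : {ω | bestSecondHop P noise h t k ω ≤ y} =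
      ⋂ j, snr P noise h t 1 k j ⁻¹' Set.Iic y := by
    ext ω
    simp [bestSecondHop_le_iff]
  have h2 : ∀ j, μ (snr P noise h t 1 k j ⁻¹' Set.Iic y) =
      ENNReal.ofReal (maxCDF 1 (P * v / noise) y) := fun j =>
    measure_le_of_map_eq_maxLaw one_ne_zero hs (hm j)
      (map_linkSNR hP hn hv hh (⟨t, ht⟩, 1, k, j)) hy
  rw [h1, hind.meas_iInter fun j => ⟨_, measurableSet_Iic, rfl⟩]
  simp only [h2, Finset.prod_const, Finset.card_univ, Fintype.card_fin]
  rw [← ENNReal.ofReal_pow (maxCDF_nonneg 1 hs hy)]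
  simp [maxCDF]

theorem iIndepFun_window [IsProbabilityMeasure μ] (hh : IsIndependentWindowModel μ T v h) {t : ℕ}
    (ht : t ∈ Finset.Icc 1 T) (i : Fin M) :
    iIndepFun (Sum.elim (fun k => snr P noise h t 0 i k) (bestSecondHop P noise h t)) μ := by
  let S : Fin M ⊕ Fin M → Set (Finset.Icc 1 T × Fin 2 × Fin M × Fin M) :=
    Sum.elim (fun k => {(⟨t, ht⟩, 0, i, k)}) fun k => {q | q.1 = ⟨t, ht⟩ ∧ q.2.1 = 1 ∧ q.2.2.1 = k}
  refine iIndepFun_of_measurable_iSup (fun q => measurable_linkSNR (P := P) (noise := noise) hh q)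
    (iIndepFun_linkSNR hh) (S := S) ?_ ?_
  · intro a b hab
    refine Set.disjoint_left.2 fun q h1 h2 => hab ?_
    rcases a with k | k <;> rcases b with l | l <;> simp [S] at h1 h2
    · simpa using h1.symm.trans h2
    · simp [h1] at h2
    · simp [h2] at h1
    · rw [← h1.2.2, ← h2.2.2]
  · rintro (k | k)
    · exact measurable_iSup_comap (f := linkSNR T P noise h) (i := (⟨t, ht⟩, 0, i, k)) (by simp [S])
    · exact measurable_bestSecondHop fun j =>
        measurable_iSup_comap (f := linkSNR T P noise h) (i := (⟨t, ht⟩, 1, k, j)) (by simp [S])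

theorem iIndepFun_lastWindow (hh : IsIndependentWindowModel μ T v h) {t : ℕ}
    (ht : t ∈ Finset.Icc 1 T) (i : Fin M) :
    iIndepFun (Sum.elim (fun k => snr P noise h t 0 i k) fun k => snr P noise h t 1 k 0) μ := by
  have := (iIndepFun_linkSNR (P := P) (noise := noise) hh).precomp
    (g := Sum.elim (fun k => ((⟨t, ht⟩, 0, i, k) : Finset.Icc 1 T × Fin 2 × Fin M × Fin M))
      fun k => (⟨t, ht⟩, 1, k, 0)) (by rintro (a | a) (b | b) hab <;> simp at hab ⊢ <;> exact hab)
  convert! this using 1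
  ext q
  rcases q with q | q <;> rfl

theorem sum_measure_selectedAbove_window [IsProbabilityMeasure μ] (hP : 0 < P) (hn : 0 < noise)
    (hv : 0 < v) (hh : IsIndependentWindowModel μ T v h) {t : ℕ} (ht : t ∈ Finset.Icc 1 T)
    (i : Fin M) {x : ℝ} (hx : 0 ≤ x) :
    ∑ k, μ (selectedAbove (snr P noise h t 0 i) (bestSecondHop P noise h t) x k) =
      ENNReal.ofReal (windowTail M (P * v / noise) x) := by
  have := sum_measure_selectedAbove (s := P * v / noise) (by positivity)
    (X := snr P noise h t 0 i) (V := bestSecondHop P noise h t)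
    (fun k => measurable_linkSNR hh (⟨t, ht⟩, 0, i, k))
    (fun k => measurable_bestSecondHop fun j => measurable_linkSNR hh (⟨t, ht⟩, 1, k, j))
    (iIndepFun_window hh ht i) (fun k => map_linkSNR hP hn hv hh (⟨t, ht⟩, 0, i, k))
    (fun k => by rw [Fintype.card_fin]; exact map_bestSecondHop hP hn hv hh ht k)
    (by
      filter_upwards [ae_linkSNR_injective hP hn hv hh] with ω hω k l hkl
      exact min_ne_of_linkSNR_injective hω ht i hkl) hx
  rwa [Fintype.card_fin] at this

theorem measure_lastWindow [IsProbabilityMeasure μ] (hP : 0 < P) (hn : 0 < noise)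
    (hv : 0 < v) (hh : IsIndependentWindowModel μ T v h) {t : ℕ} (ht : t ∈ Finset.Icc 1 T)
    (i : Fin M) {x : ℝ} (hx : 0 ≤ x) :
    μ {ω | ∃ k, x < min (snr P noise h t 0 i k ω) (snr P noise h t 1 k 0 ω)} =
      ENNReal.ofReal (1 - (1 - Real.exp (-2 * x / (P * v / noise))) ^ M) := by
  have hs : 0 < P * v / noise := by positivity
  have hX : ∀ k, Measurable (snr P noise h t 0 i k) := fun k =>
    measurable_linkSNR hh (⟨t, ht⟩, 0, i, k)
  have hV : ∀ k, Measurable (snr P noise h t 1 k 0) := fun k =>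
    measurable_linkSNR hh (⟨t, ht⟩, 1, k, 0)
  have h1 := measure_forall_min_le one_ne_zero hs (X := snr P noise h t 0 i)
    (V := fun k => snr P noise h t 1 k 0) hX hV (iIndepFun_lastWindow hh ht i)
    (fun k => map_linkSNR hP hn hv hh (⟨t, ht⟩, 0, i, k))
    (fun k => map_linkSNR hP hn hv hh (⟨t, ht⟩, 1, k, 0)) hx
  have h2 : {ω | ∃ k, x < min (snr P noise h t 0 i k ω) (snr P noise h t 1 k 0 ω)} =
      {ω | ∀ k, min (snr P noise h t 0 i k ω) (snr P noise h t 1 k 0 ω) ≤ x}ᶜ := by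
    ext ω
    simp only [Set.mem_ofPred_eq, Set.mem_compl_iff, not_forall, not_le]
  have hmeas : MeasurableSet
      {ω | ∀ k, min (snr P noise h t 0 i k ω) (snr P noise h t 1 k 0 ω) ≤ x} := by
    rw [Set.ofPred_forall]
    exact MeasurableSet.iInter fun k => measurableSet_le ((hX k).min (hV k)) measurable_const
  -- With the endpoint fixed, the second hop offers a single link, so a path SNR is a minimum of two
  -- exponentials.
  have h3 : pathCDF 1 (P * v / noise) x = 1 - Real.exp (-2 * x / (P * v / noise)) := by
    have : Real.exp (-2 * x / (P * v / noise)) =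
        Real.exp (-x / (P * v / noise)) * Real.exp (-x / (P * v / noise)) := by
      rw [← Real.exp_add]; congr 1; ring
    simp only [pathCDF, maxCDF, pow_one, this]
    ring
  rw [h2, prob_compl_eq_one_sub hmeas, h1, Fintype.card_fin, ← ENNReal.ofReal_one,
    ← ENNReal.ofReal_sub _ (pow_nonneg (pathCDF_nonneg 1 hs hx) _), h3]

end Channels

/-! ### Chaining the windows -/

section RelaySelection

variable {Ω : Type*} {M : ℕ} [NeZero M] {P noise : ℝ} {h : WindowChannels Ω M}

/-- The strictly best choices in windows `1, …, t` lead to relay `k`, all hops having SNR above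
`x`. -/
def survival (P noise : ℝ) (h : WindowChannels Ω M) (x : ℝ) : ℕ → Fin M → Set Ω
  | 0 => fun k => if k = 0 then Set.univ else ∅
  | t + 1 => fun k => ⋃ i, survival P noise h x t i ∩
      selectedAbove (snr P noise h (t + 1) 0 i) (bestSecondHop P noise h (t + 1)) x k

theorem pairwise_disjoint_survival (x : ℝ) (t : ℕ) :
    Pairwise (Function.onFun Disjoint (survival P noise h x t)) := by
  induction t with
  | zero =>
    intro k l hkl
    refine Set.disjoint_left.2 fun ω h1 h2 => ?_
    by_cases hk : k = 0 <;> by_cases hl : l = 0 <;> simp_all [survival]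
  | succ t ih =>
    intro k l hkl
    refine Set.disjoint_left.2 fun ω h1 h2 => ?_
    obtain ⟨i, hi, hik⟩ := Set.mem_iUnion.1 h1
    obtain ⟨j, hj, hjl⟩ := Set.mem_iUnion.1 h2
    by_cases hij : i = j
    · subst hij
      exact Set.disjoint_left.1 (pairwise_disjoint_selectedAbove _ _ x hkl) hik hjl
    · exact Set.disjoint_left.1 (ih hij) hi hj

/-- End-to-end event in terms of `survival`. -/
def totalSurvival (P noise : ℝ) (h : WindowChannels Ω M) (x : ℝ) (t : ℕ) : Set Ω :=
  ⋃ i, survival P noise h x t i ∩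
    {ω | ∃ k, x < min (snr P noise h (t + 1) 0 i k ω) (snr P noise h (t + 1) 1 k 0 ω)}

variable {T : ℕ} {r : ℕ → Ω → Fin M}

/-- Maximizing over both nodes of a path amounts to maximizing over the first relay with its best
second link. -/
theorem IsSlidingSelection.window_le (hP : 0 < P) (hn : 0 < noise)
    (hr : IsSlidingSelection T P noise h r) {t : ℕ} (h1 : 1 ≤ t) (h2 : t < T) (ω : Ω) (k : Fin M) :
    min (snr P noise h t 0 (r (t - 1) ω) k ω) (bestSecondHop P noise h t k ω) ≤
      min (snr P noise h t 0 (r (t - 1) ω) (r t ω) ω) (bestSecondHop P noise h t (r t ω) ω) := by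
  obtain ⟨j, hj⟩ := hr.window t h1 h2 ω
  obtain ⟨j', hj'⟩ := exists_bestSecondHop_eq (P := P) (noise := noise) (h := h) t k ω
  rw [hj']
  exact ((windowRate_le_iff hP hn).1 (hj k j')).trans
    (min_le_min_left _ (snr_le_bestSecondHop t _ j ω))

/-- Replaces the arbitrary selection `r` by events in the channels alone: without ties the maximizer
is unique, so the tie-breaking rule is irrelevant. The last window is excluded because its endpoint
is prescribed. -/
theorem mem_survival_iff (hP : 0 < P) (hn : 0 < noise) (hr : IsSlidingSelection T P noise h r)
    {ω : Ω} (hinj : Function.Injective fun q => linkSNR T P noise h q ω) {x : ℝ} {t : ℕ} :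
    t < T → ∀ k, ω ∈ survival P noise h x t k ↔
      r t ω = k ∧ ∀ l, 1 ≤ l → l ≤ t → x < hopSNR T P noise h r l ω := by
  induction t with
  | zero =>
    intro _ k
    have h0 := hr.source ω
    by_cases hk : k = 0
    · subst hk
      simp only [survival, if_true, Set.mem_univ, h0, true_and, true_iff]
      omega
    · simp [survival, hk, h0, Ne.symm hk]
  | succ t ih =>
    intro ht k
    have hhop : hopSNR T P noise h r (t + 1) ω =
        snr P noise h (t + 1) 0 (r t ω) (r (t + 1) ω) ω := by
      rw [hopSNR, if_pos (by omega), Nat.add_sub_cancel]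
    have hle := hr.window_le hP hn (t := t + 1) (by omega) ht ω
    rw [Nat.add_sub_cancel] at hle
    simp only [survival, Set.mem_iUnion, Set.mem_inter_iff, ih (by omega)]
    constructor
    · rintro ⟨i, ⟨rfl, hl⟩, hk, hxk⟩
      have hrk : r (t + 1) ω = k := by
        by_contra hne
        exact (hle k).not_gt (hk _ hne)
      refine ⟨hrk, fun l h1 h2 => ?_⟩
      rcases Nat.lt_or_ge l (t + 1) with h3 | h3
      · exact hl l h1 (by omega)
      · rw [show l = t + 1 by omega, hhop, hrk]
        exact hxk
    · rintro ⟨rfl, hl⟩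
      refine ⟨r t ω, ⟨rfl, fun l h1 h2 => hl l h1 (by omega)⟩, fun l hl => ?_, ?_⟩
      · exact lt_of_le_of_ne (hle l) (min_ne_of_linkSNR_injective hinj
          (Finset.mem_Icc.2 ⟨by omega, ht.le⟩) _ hl)
      · rw [← hhop]
        exact hl _ (by omega) le_rfl

theorem mem_totalSurvival_iff {n : ℕ} (hP : 0 < P) (hn : 0 < noise)
    (hr : IsSlidingSelection (n + 1) P noise h r)
    {ω : Ω} (hinj : Function.Injective fun q => linkSNR (n + 1) P noise h q ω) {x : ℝ} :
    ω ∈ totalSurvival P noise h x n ↔ x < endToEndSNR (n + 1) P noise h r ω := by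
  have hlast : ∀ k, min (snr P noise h (n + 1) 0 (r n ω) k ω) (snr P noise h (n + 1) 1 k 0 ω) ≤
      min (snr P noise h (n + 1) 0 (r n ω) (r (n + 1) ω) ω)
        (snr P noise h (n + 1) 1 (r (n + 1) ω) 0 ω) := fun k =>
    (windowRate_le_iff hP hn).1 (hr.last ω k)
  have hop1 : hopSNR (n + 1) P noise h r (n + 1) ω =
      snr P noise h (n + 1) 0 (r n ω) (r (n + 1) ω) ω := by
    rw [hopSNR, if_pos le_rfl, Nat.add_sub_cancel]
  have hop2 : hopSNR (n + 1) P noise h r (n + 2) ω =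
      snr P noise h (n + 1) 1 (r (n + 1) ω) 0 ω := by
    rw [hopSNR, if_neg (by omega), hr.destination]
    rfl
  rw [lt_endToEndSNR_iff]
  simp only [totalSurvival, Set.mem_iUnion, Set.mem_inter_iff, mem_survival_iff hP hn hr hinj
    (Nat.lt_succ_self n), Set.mem_ofPred_eq]
  constructor
  · rintro ⟨i, ⟨rfl, hl⟩, k, hk⟩ l h1 h2
    have hk' := lt_min_iff.1 (hk.trans_le (hlast k))
    rcases Nat.lt_or_ge l (n + 1) with h3 | h3
    · exact hl l h1 (by omega)
    rcases Nat.eq_or_lt_of_le h3 with h4 | h4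
    · rw [← h4, hop1]
      exact hk'.1
    · rw [show l = n + 2 by omega, hop2]
      exact hk'.2
  · intro hl
    refine ⟨r n ω, ⟨rfl, fun l h1 h2 => hl l h1 (by omega)⟩, r (n + 1) ω, lt_min ?_ ?_⟩
    · rw [← hop1]
      exact hl _ (by omega) (by omega)
    · rw [← hop2]
      exact hl _ (by omega) (by omega)

theorem measurableSet_lastWindow {m' : MeasurableSpace Ω} {t : ℕ} {i : Fin M}
    (hX : ∀ k, Measurable[m'] (snr P noise h t 0 i k))
    (hV : ∀ k, Measurable[m'] (snr P noise h t 1 k 0)) (x : ℝ) : MeasurableSet[m']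
      {ω | ∃ k, x < min (snr P noise h t 0 i k ω) (snr P noise h t 1 k 0 ω)} := by
  rw [Set.ofPred_exists]
  exact MeasurableSet.iUnion fun k => measurableSet_lt measurable_const ((hX k).min (hV k))

theorem measurableSet_survival (x : ℝ) {t : ℕ} (ht : t ≤ T) (k : Fin M) :
    MeasurableSet[⨆ q ∈ {q : Finset.Icc 1 T × Fin 2 × Fin M × Fin M | (q.1 : ℕ) ≤ t},
      Real.measurableSpace.comap (linkSNR T P noise h q)] (survival P noise h x t k) := by
  induction t generalizing k with
  | zero =>
    by_cases hk : k = 0 <;> simp [survival, hk]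
  | succ t ih =>
    have hT : t + 1 ∈ Finset.Icc 1 T := Finset.mem_Icc.2 ⟨by omega, ht⟩
    refine MeasurableSet.iUnion fun i => MeasurableSet.inter ?_ ?_
    · have hle : (⨆ q ∈ {q : Finset.Icc 1 T × Fin 2 × Fin M × Fin M | (q.1 : ℕ) ≤ t},
          Real.measurableSpace.comap (linkSNR T P noise h q)) ≤
          ⨆ q ∈ {q : Finset.Icc 1 T × Fin 2 × Fin M × Fin M | (q.1 : ℕ) ≤ t + 1},
          Real.measurableSpace.comap (linkSNR T P noise h q) :=
        biSup_mono fun q (hq : (q.1 : ℕ) ≤ t) => hq.trans (Nat.le_succ t)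
      exact hle _ (ih (by omega) i)
    · exact measurableSet_selectedAbove
        (fun k => measurable_iSup_comap (f := linkSNR T P noise h) (i := (⟨t + 1, hT⟩, 0, i, k))
          (by simp))
        (fun k => measurable_bestSecondHop fun j =>
          measurable_iSup_comap (f := linkSNR T P noise h) (i := (⟨t + 1, hT⟩, 1, k, j)) (by simp))
        x k

variable [MeasurableSpace Ω] {μ : Measure Ω} {v : ℝ}

theorem measurableSet_survival' (hh : IsIndependentWindowModel μ T v h) (x : ℝ) {t : ℕ}
    (ht : t ≤ T) (k : Fin M) : MeasurableSet (survival P noise h x t k) := by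
  have hle : (⨆ q ∈ {q : Finset.Icc 1 T × Fin 2 × Fin M × Fin M | (q.1 : ℕ) ≤ t},
      Real.measurableSpace.comap (linkSNR T P noise h q)) ≤ ‹MeasurableSpace Ω› :=
    iSup₂_le fun q _ => (measurable_linkSNR hh q).comap_le
  exact hle _ (measurableSet_survival x ht k)

theorem measure_survival_inter (hh : IsIndependentWindowModel μ T v h) (x : ℝ) {t : ℕ}
    (ht : t + 1 ∈ Finset.Icc 1 T) (i : Fin M) {A : Set Ω}
    (hA : MeasurableSet[⨆ q ∈ {q : Finset.Icc 1 T × Fin 2 × Fin M × Fin M | (q.1 : ℕ) = t + 1},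
      Real.measurableSpace.comap (linkSNR T P noise h q)] A) :
    μ (survival P noise h x t i ∩ A) = μ (survival P noise h x t i) * μ A := by
  refine (Indep_iff _ _ μ).1 (indep_iSup_of_disjoint
    (fun q => (measurable_linkSNR (P := P) (noise := noise) hh q).comap_le)
    (iIndepFun_linkSNR hh).iIndep ?_) _ _
    (measurableSet_survival x ((Nat.le_succ t).trans (Finset.mem_Icc.1 ht).2) i) hA
  refine Set.disjoint_left.2 fun q h1 h2 => ?_
  simp only [Set.mem_ofPred_eq] at h1 h2
  omega

theorem sum_measure_survival [IsProbabilityMeasure μ] (hP : 0 < P) (hn : 0 < noise) (hv : 0 < v)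
    (hh : IsIndependentWindowModel μ T v h) {x : ℝ} (hx : 0 ≤ x) {t : ℕ} (ht : t ≤ T) :
    ∑ k, μ (survival P noise h x t k) =
      ENNReal.ofReal (windowTail M (P * v / noise) x) ^ t := by
  induction t with
  | zero =>
    rw [Finset.sum_eq_single 0]
    · simp [survival]
    · intro k _ hk
      simp [survival, hk]
    · simp
  | succ t ih =>
    have hT : t + 1 ∈ Finset.Icc 1 T := Finset.mem_Icc.2 ⟨by omega, ht⟩
    have hX : ∀ i k, Measurable (snr P noise h (t + 1) 0 i k) := fun i k =>
      measurable_linkSNR hh (⟨t + 1, hT⟩, 0, i, k)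
    have hV : ∀ k, Measurable (bestSecondHop P noise h (t + 1) k) := fun k =>
      measurable_bestSecondHop fun j => measurable_linkSNR hh (⟨t + 1, hT⟩, 1, k, j)
    have hstep : ∀ k, μ (survival P noise h x (t + 1) k) = ∑ i, μ (survival P noise h x t i) *
        μ (selectedAbove (snr P noise h (t + 1) 0 i) (bestSecondHop P noise h (t + 1)) x k) := by
      intro k
      rw [survival, measure_iUnion, tsum_fintype]
      · refine Finset.sum_congr rfl fun i _ => measure_survival_inter hh x hT i ?_
        exact measurableSet_selectedAbove
          (fun k => measurable_iSup_comap (f := linkSNR T P noise h)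
            (i := (⟨t + 1, hT⟩, 0, i, k)) (by simp))
          (fun k => measurable_bestSecondHop fun j => measurable_iSup_comap
            (f := linkSNR T P noise h) (i := (⟨t + 1, hT⟩, 1, k, j)) (by simp)) x k
      · intro i j hij
        exact (pairwise_disjoint_survival x t hij).mono Set.inter_subset_left Set.inter_subset_left
      · exact fun i => (measurableSet_survival' hh x (by omega) i).inter
          (measurableSet_selectedAbove (hX i) hV x k)
    simp only [hstep]
    -- Summing over the new relay first gives a factor that does not depend on the previous relay
    -- `i`, so it comes out of the sum.
    rw [Finset.sum_comm]
    simp only [← Finset.mul_sum, sum_measure_selectedAbove_window hP hn hv hh hT _ hx]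
    rw [← Finset.sum_mul, ih (by omega), pow_succ]

theorem measurableSet_totalSurvival {n : ℕ} (hh : IsIndependentWindowModel μ (n + 1) v h) (x : ℝ) :
    MeasurableSet (totalSurvival P noise h x n) := by
  have hT : n + 1 ∈ Finset.Icc 1 (n + 1) := Finset.mem_Icc.2 ⟨by omega, le_rfl⟩
  exact MeasurableSet.iUnion fun i => (measurableSet_survival' hh x (by omega) i).inter
    (measurableSet_lastWindow (fun k => measurable_linkSNR hh (⟨n + 1, hT⟩, 0, i, k))
      (fun k => measurable_linkSNR hh (⟨n + 1, hT⟩, 1, k, 0)) x)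

theorem measure_totalSurvival [IsProbabilityMeasure μ] (hP : 0 < P) (hn : 0 < noise) (hv : 0 < v)
    {n : ℕ} (hh : IsIndependentWindowModel μ (n + 1) v h) {x : ℝ} (hx : 0 ≤ x) :
    μ (totalSurvival P noise h x n) = ENNReal.ofReal (windowTail M (P * v / noise) x) ^ n *
      ENNReal.ofReal (1 - (1 - Real.exp (-2 * x / (P * v / noise))) ^ M) := by
  have hT : n + 1 ∈ Finset.Icc 1 (n + 1) := Finset.mem_Icc.2 ⟨by omega, le_rfl⟩
  rw [totalSurvival, measure_iUnion, tsum_fintype]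
  · rw [← sum_measure_survival hP hn hv hh hx (Nat.le_succ n), Finset.sum_mul]
    refine Finset.sum_congr rfl fun i _ => ?_
    rw [← measure_lastWindow hP hn hv hh hT i hx]
    exact measure_survival_inter hh x hT i (measurableSet_lastWindow
      (fun k => measurable_iSup_comap (f := linkSNR (n + 1) P noise h)
        (i := (⟨n + 1, hT⟩, 0, i, k)) (by simp))
      (fun k => measurable_iSup_comap (f := linkSNR (n + 1) P noise h)
        (i := (⟨n + 1, hT⟩, 1, k, 0)) (by simp)) x)
  · intro i j hij
    exact (pairwise_disjoint_survival x n hij).mono Set.inter_subset_left Set.inter_subset_left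
  · exact fun i => (measurableSet_survival' hh x (by omega) i).inter
      (measurableSet_lastWindow (fun k => measurable_linkSNR hh (⟨n + 1, hT⟩, 0, i, k))
        (fun k => measurable_linkSNR hh (⟨n + 1, hT⟩, 1, k, 0)) x)

end RelaySelection

/-! ### Distribution of the end-to-end SNR and the rate -/

section Rate

theorem windowTail_nonneg {M : ℕ} (hM : M ≠ 0) {s x : ℝ} (hs : 0 < s) (hx : 0 ≤ x) :
    0 ≤ windowTail M s x := by
  obtain ⟨m, rfl⟩ : ∃ m, M = m + 1 := ⟨M - 1, by omega⟩
  have hI := integral_maxPDF_mul_pathCDF_nonneg (m + 1) m hs hx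
  have hp1 := pathCDF_le_one (m + 1) hs hx
  rw [windowTail_eq m hs.ne']
  exact add_nonneg (sub_nonneg.2 (pow_le_one₀ (pathCDF_nonneg _ hs hx) hp1)) (by positivity)

theorem one_sub_pow_mul_sum_pow_eq (M n : ℕ) {Q : ℕ} (a b : Fin Q → ℝ) (s x : ℝ) :
    (1 - (1 - Real.exp (-2 * x / s)) ^ M) * (∑ q, a q * Real.exp (-b q * x / s)) ^ n =
      ∑ i ∈ Finset.Icc 1 M, ∑ l ∈ Finset.piAntidiag (Finset.univ : Finset (Fin Q)) n,
        -coeffA M a i l * Real.exp (-(coeffBeta b i l / s) * x) := by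
  have h1 : 1 - (1 - Real.exp (-2 * x / s)) ^ M =
      ∑ i ∈ Finset.Icc 1 M, -((M.choose i : ℝ) * (-1) ^ i) * Real.exp (-(2 * i / s) * x) := by
    have hI : Finset.Icc 1 M = Finset.Ico (0 + 1) (M + 1) := by
      ext N; simp only [Finset.mem_Icc, Finset.mem_Ico]; omega
    -- The term `i = 0` of the binomial expansion cancels the leading `1`.
    rw [hI, ← Finset.sum_Ico_add' _ 0 M 1, ← Finset.range_eq_Ico, sub_eq_neg_add 1 (Real.exp _),
      add_pow, Finset.sum_range_succ']
    simp only [one_pow, mul_one, pow_zero, Nat.choose_zero_right, Nat.cast_one,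
      sub_add_cancel_right]
    rw [← Finset.sum_neg_distrib]
    refine Finset.sum_congr rfl fun i _ => ?_
    rw [neg_pow, ← Real.exp_nat_mul]
    have : ((i + 1 : ℕ) : ℝ) * (-2 * x / s) = -(2 * ((i + 1 : ℕ) : ℝ) / s) * x := by ring
    rw [this]
    ring
  rw [h1, Finset.sum_pow_eq_sum_piAntidiag, Finset.sum_mul_sum]
  refine Finset.sum_congr rfl fun i _ => Finset.sum_congr rfl fun l _ => ?_
  have h2 : ∏ q, (a q * Real.exp (-b q * x / s)) ^ l q =
      (∏ q, a q ^ l q) * Real.exp (-((∑ q, b q * (l q : ℝ)) / s) * x) := by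
    simp only [mul_pow, Finset.prod_mul_distrib]
    congr 1
    simp only [← Real.exp_nat_mul]
    rw [← Real.exp_sum]
    congr 1
    rw [Finset.sum_div, ← Finset.sum_neg_distrib, Finset.sum_mul]
    exact Finset.sum_congr rfl fun q _ => by ring
  have h3 : Real.exp (-(coeffBeta b i l / s) * x) = Real.exp (-(2 * (i : ℝ) / s) * x) *
      Real.exp (-((∑ q, b q * (l q : ℝ)) / s) * x) := by
    rw [← Real.exp_add, coeffBeta]
    congr 1
    ring
  rw [h2, h3, coeffA]
  ring

theorem integrableOn_exp_neg_div_one_add {c : ℝ} (hc : 0 < c) :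
    IntegrableOn (fun t : ℝ => Real.exp (-c * t) / (1 + t)) (Set.Ioi 0) := by
  refine Integrable.mono' (exp_neg_integrableOn_Ioi 0 hc) ?_ ?_
  · exact Measurable.aestronglyMeasurable (by fun_prop)
  · refine (ae_restrict_iff' measurableSet_Ioi).2 (ae_of_all _ fun t ht => ?_)
    have ht0 : (0 : ℝ) < t := ht
    rw [Real.norm_of_nonneg (by positivity)]
    exact div_le_self (Real.exp_pos _).le (by linarith)

/-- Substitute `u = c (1 + t)`. -/
theorem integral_exp_neg_div_one_add {c : ℝ} (hc : 0 < c) :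
    ∫ t in Set.Ioi (0 : ℝ), Real.exp (-c * t) / (1 + t) = -(Real.exp c * Ei (-c)) := by
  have h1 := integral_comp_mul_left_Ioi (fun u => Real.exp (-u) / u) 1 hc
  have h2 : ∫ t in Set.Ioi (0 : ℝ), Real.exp (-(c * (1 + t))) / (c * (1 + t)) =
      ∫ y in Set.Ioi (1 : ℝ), Real.exp (-(c * y)) / (c * y) := by
    have hmp := measurePreserving_add_left (volume : Measure ℝ) 1
    have hpre : (fun t : ℝ => 1 + t) ⁻¹' Set.Ioi 1 = Set.Ioi 0 := by ext; simp
    rw [← hpre]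
    exact hmp.setIntegral_preimage_emb (measurableEmbedding_addLeft 1)
      (fun y => Real.exp (-(c * y)) / (c * y)) _
  rw [← h2, mul_one, smul_eq_mul] at h1
  have h3 : ∀ t : ℝ, Real.exp (-c * t) / (1 + t) =
      (Real.exp c * c) * (Real.exp (-(c * (1 + t))) / (c * (1 + t))) := by
    intro t
    have : Real.exp (-(c * (1 + t))) = Real.exp (-c) * Real.exp (-c * t) := by
      rw [← Real.exp_add]; congr 1; ring
    rw [this, Real.exp_neg c]
    have := Real.exp_pos c
    -- The identity is claimed for all real `t`; at `t = -1` both sides are zero by the convention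
    -- for division by zero.
    rcases eq_or_ne (1 + t) 0 with h | h
    · simp [h]
    · field_simp
  simp only [h3]
  rw [integral_const_mul, h1, Ei, neg_neg]
  field_simp

theorem cdf_endToEndSNR_of_neg {Ω : Type*} [MeasurableSpace Ω] {μ : Measure Ω} {M n : ℕ}
    [NeZero M] {P noise : ℝ} {h : WindowChannels Ω M} {r : ℕ → Ω → Fin M} (hP : 0 < P)
      (hn : 0 < noise) {x : ℝ}
    (hx : x < 0) :
    μ.real {ω | endToEndSNR (n + 1) P noise h r ω ≤ x} = 0 := by
  have : {ω | endToEndSNR (n + 1) P noise h r ω ≤ x} = ∅ := by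
    ext ω
    simpa using hx.trans_le (endToEndSNR_nonneg hP hn (n + 1) r ω)
  rw [this, measureReal_empty]

variable {Ω : Type*} [MeasurableSpace Ω] {μ : Measure Ω} [IsProbabilityMeasure μ] {M n : ℕ}
  [NeZero M] {P noise v s : ℝ} {h : WindowChannels Ω M} {r : ℕ → Ω → Fin M}

theorem totalSurvival_ae_eq (hP : 0 < P) (hn : 0 < noise) (hv : 0 < v)
    (hh : IsIndependentWindowModel μ (n + 1) v h) (hr : IsSlidingSelection (n + 1) P noise h r)
    (x : ℝ) : ({ω | x < endToEndSNR (n + 1) P noise h r ω} : Set Ω) =ᵐ[μ]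
      totalSurvival P noise h x n := by
  filter_upwards [ae_linkSNR_injective hP hn hv hh] with ω hω
  exact propext (mem_totalSurvival_iff hP hn hr hω).symm

theorem nullMeasurableSet_lt_endToEndSNR (hP : 0 < P) (hn : 0 < noise) (hv : 0 < v)
    (hh : IsIndependentWindowModel μ (n + 1) v h) (hr : IsSlidingSelection (n + 1) P noise h r)
    (x : ℝ) : NullMeasurableSet {ω | x < endToEndSNR (n + 1) P noise h r ω} μ :=
  ((measurableSet_totalSurvival hh x).nullMeasurableSet).congr
    (totalSurvival_ae_eq hP hn hv hh hr x).symm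

theorem aemeasurable_endToEndSNR (hP : 0 < P) (hn : 0 < noise) (hv : 0 < v)
    (hh : IsIndependentWindowModel μ (n + 1) v h) (hr : IsSlidingSelection (n + 1) P noise h r) :
    AEMeasurable (endToEndSNR (n + 1) P noise h r) μ := by
  refine NullMeasurable.aemeasurable ?_
  -- As `r` may be nonmeasurable, only the completed σ-algebra is available.
  exact measurable_of_Ioi (δ := NullMeasurableSpace Ω μ)
    fun x => nullMeasurableSet_lt_endToEndSNR hP hn hv hh hr x

theorem measure_lt_endToEndSNR (hP : 0 < P) (hn : 0 < noise) (hv : 0 < v) (hs : s = P * v / noise)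
    (hh : IsIndependentWindowModel μ (n + 1) v h) (hr : IsSlidingSelection (n + 1) P noise h r)
    {x : ℝ} (hx : 0 ≤ x) : μ {ω | x < endToEndSNR (n + 1) P noise h r ω} =
      ENNReal.ofReal ((1 - (1 - Real.exp (-2 * x / s)) ^ M) * windowTail M s x ^ n) := by
  have hs0 : 0 < P * v / noise := by positivity
  have hw := windowTail_nonneg (NeZero.ne M) hs0 hx
  rw [measure_congr (totalSurvival_ae_eq hP hn hv hh hr x), measure_totalSurvival hP hn hv hh hx,
    ← ENNReal.ofReal_pow hw, ← ENNReal.ofReal_mul (pow_nonneg hw n), mul_comm, hs]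

theorem tail_nonneg (hs : 0 < s) {x : ℝ} (hx : 0 ≤ x) :
    0 ≤ (1 - (1 - Real.exp (-2 * x / s)) ^ M) * windowTail M s x ^ n := by
  have h1 : Real.exp (-2 * x / s) ≤ 1 := by
    rw [Real.exp_le_one_iff, neg_mul, neg_div]
    have : 0 ≤ 2 * x / s := by positivity
    linarith
  have h2 := Real.exp_pos (-2 * x / s)
  exact mul_nonneg (sub_nonneg.2 (pow_le_one₀ (by linarith) (by linarith)))
    (pow_nonneg (windowTail_nonneg (NeZero.ne M) hs hx) n)

theorem cdf_endToEndSNR (hP : 0 < P) (hn : 0 < noise) (hv : 0 < v) (hs : s = P * v / noise)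
    (hh : IsIndependentWindowModel μ (n + 1) v h) (hr : IsSlidingSelection (n + 1) P noise h r)
    {x : ℝ} (hx : 0 ≤ x) : μ.real {ω | endToEndSNR (n + 1) P noise h r ω ≤ x} =
      1 - (1 - (1 - Real.exp (-2 * x / s)) ^ M) * windowTail M s x ^ n := by
  have hs0 : 0 < s := by rw [hs]; positivity
  have h1 : {ω | endToEndSNR (n + 1) P noise h r ω ≤ x} =
      {ω | x < endToEndSNR (n + 1) P noise h r ω}ᶜ := by ext; simp
  rw [h1, Measure.real, prob_compl_eq_one_sub₀ (nullMeasurableSet_lt_endToEndSNR hP hn hv hh hr x),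
    ENNReal.toReal_sub_of_le prob_le_one ENNReal.one_ne_top,
    measure_lt_endToEndSNR hP hn hv hs hh hr hx, ENNReal.toReal_ofReal (tail_nonneg hs0 hx),
    ENNReal.toReal_one]

theorem integrable_and_integral_log (hP : 0 < P) (hn : 0 < noise) (hv : 0 < v)
    (hs : s = P * v / noise)
    (hh : IsIndependentWindowModel μ (n + 1) v h) (hr : IsSlidingSelection (n + 1) P noise h r)
    {Q : ℕ} (a b : Fin Q → ℝ) (hb : ∀ q, 0 ≤ b q)
    (hab : ∀ x : ℝ, 0 ≤ x → ∑ q, a q * Real.exp (-b q * x / s) = windowTail M s x) :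
    Integrable (fun ω => Real.log (1 + endToEndSNR (n + 1) P noise h r ω)) μ ∧
      ∫ ω, Real.log (1 + endToEndSNR (n + 1) P noise h r ω) ∂μ =
        ∑ i ∈ Finset.Icc 1 M, ∑ l ∈ Finset.piAntidiag (Finset.univ : Finset (Fin Q)) n,
          coeffA M a i l * Real.exp (coeffBeta b i l / s) * Ei (-(coeffBeta b i l / s)) := by
  have hs0 : 0 < s := by rw [hs]; positivity
  set γ := endToEndSNR (n + 1) P noise h r
  have hγ0 : ∀ ω, 0 ≤ γ ω := endToEndSNR_nonneg hP hn (n + 1) r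
  have hγm : AEMeasurable γ μ := aemeasurable_endToEndSNR hP hn hv hh hr
  let G : ℝ → ℝ := fun t => ∑ i ∈ Finset.Icc 1 M,
    ∑ l ∈ Finset.piAntidiag (Finset.univ : Finset (Fin Q)) n,
      -coeffA M a i l * (Real.exp (-(coeffBeta b i l / s) * t) / (1 + t))
  -- The summand `2 i` with `i ≥ 1` keeps the exponent positive even if every `b q` is zero, so each
  -- integral converges.
  have hβ : ∀ i ∈ Finset.Icc 1 M, ∀ l : Fin Q → ℕ, 0 < coeffBeta b i l / s := by
    intro i hi l
    have hi1 : (1 : ℝ) ≤ i := by exact_mod_cast (Finset.mem_Icc.1 hi).1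
    have : 0 ≤ ∑ q, b q * (l q : ℝ) :=
      Finset.sum_nonneg fun q _ => mul_nonneg (hb q) (Nat.cast_nonneg _)
    unfold coeffBeta
    positivity
  have hG : ∀ t, 0 ≤ t → G t =
      ((1 - (1 - Real.exp (-2 * t / s)) ^ M) * windowTail M s t ^ n) * (1 / (1 + t)) := by
    intro t ht
    rw [← hab t ht, one_sub_pow_mul_sum_pow_eq, Finset.sum_mul]
    refine Finset.sum_congr rfl fun i _ => ?_
    rw [Finset.sum_mul]
    exact Finset.sum_congr rfl fun l _ => by ring
  have hG0 : ∀ᵐ t ∂(volume.restrict (Set.Ioi (0 : ℝ))), 0 ≤ G t := by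
    refine (ae_restrict_iff' measurableSet_Ioi).2 (ae_of_all _ fun t ht => ?_)
    have ht0 : (0 : ℝ) < t := ht
    rw [hG t ht0.le]
    exact mul_nonneg (tail_nonneg hs0 ht0.le) (by positivity)
  have hGi : IntegrableOn G (Set.Ioi 0) :=
    integrable_finsetSum _ fun i hi => integrable_finsetSum _ fun l _ =>
      (integrableOn_exp_neg_div_one_add (hβ i hi l)).const_mul _
  have hGI : ∫ t in Set.Ioi (0 : ℝ), G t = ∑ i ∈ Finset.Icc 1 M,
      ∑ l ∈ Finset.piAntidiag (Finset.univ : Finset (Fin Q)) n,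
        coeffA M a i l * Real.exp (coeffBeta b i l / s) * Ei (-(coeffBeta b i l / s)) := by
    rw [integral_finsetSum _ fun i hi => integrable_finsetSum _ fun l _ =>
      (integrableOn_exp_neg_div_one_add (hβ i hi l)).const_mul _]
    refine Finset.sum_congr rfl fun i hi => ?_
    rw [integral_finsetSum _ fun l _ =>
      (integrableOn_exp_neg_div_one_add (hβ i hi l)).const_mul _]
    refine Finset.sum_congr rfl fun l _ => ?_
    rw [integral_const_mul, integral_exp_neg_div_one_add (hβ i hi l)]
    ring
  have hlog : ∀ ω, ∫ t in (0 : ℝ)..γ ω, 1 / (1 + t) = Real.log (1 + γ ω) := by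
    intro ω
    have hd : ∀ t ∈ Set.uIcc 0 (γ ω), HasDerivAt (fun t => Real.log (1 + t)) (1 / (1 + t)) t := by
      intro t ht
      rw [Set.uIcc_of_le (hγ0 ω)] at ht
      exact ((hasDerivAt_id t).const_add 1).log (by have := ht.1; simp only [id]; linarith)
    rw [intervalIntegral.integral_eq_sub_of_hasDerivAt hd]
    · simp
    · refine ContinuousOn.intervalIntegrable fun t ht => ContinuousAt.continuousWithinAt ?_
      rw [Set.uIcc_of_le (hγ0 ω)] at ht
      have : 1 + t ≠ 0 := by have := ht.1; linarith
      fun_prop (disch := assumption)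
  -- Layer-cake formula with the derivative of `log (1 + t)` as weight. In `ENNReal` it yields
  -- integrability and the value together.
  have hcake := lintegral_comp_eq_lintegral_meas_lt_mul μ (f := γ) (g := fun t => 1 / (1 + t))
    (ae_of_all _ hγ0) hγm
    (fun t ht => by
      refine ContinuousOn.intervalIntegrable fun y hy => ContinuousAt.continuousWithinAt ?_
      rw [Set.uIcc_of_le (le_of_lt ht)] at hy
      have : 1 + y ≠ 0 := by have := hy.1; linarith
      fun_prop (disch := assumption))
    ((ae_restrict_iff' measurableSet_Ioi).2 (ae_of_all _ fun t ht => by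
      have ht0 : (0 : ℝ) < t := ht
      positivity))
  simp only [hlog] at hcake
  have hright : ∫⁻ t in Set.Ioi (0 : ℝ), μ {ω | t < γ ω} * ENNReal.ofReal (1 / (1 + t)) =
      ENNReal.ofReal (∫ t in Set.Ioi (0 : ℝ), G t) := by
    rw [ofReal_integral_eq_lintegral_ofReal hGi hG0]
    refine setLIntegral_congr_fun measurableSet_Ioi fun t ht => ?_
    have ht0 : (0 : ℝ) ≤ t := le_of_lt ht
    rw [hG t ht0, ENNReal.ofReal_mul (tail_nonneg hs0 ht0)]
    congr 1
    exact measure_lt_endToEndSNR hP hn hv hs hh hr ht0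
  rw [hright] at hcake
  have hlog0 : ∀ ω, 0 ≤ Real.log (1 + γ ω) := fun ω =>
    Real.log_nonneg (by linarith [hγ0 ω])
  have hlogm : AEStronglyMeasurable (fun ω => Real.log (1 + γ ω)) μ :=
    (Real.measurable_log.comp_aemeasurable (hγm.const_add 1)).aestronglyMeasurable
  refine ⟨⟨hlogm, ?_⟩, ?_⟩
  · rw [hasFiniteIntegral_iff_ofReal (ae_of_all _ hlog0), hcake]
    exact ENNReal.ofReal_lt_top
  · rw [integral_eq_lintegral_of_nonneg_ae (ae_of_all _ hlog0) hlogm, hcake,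
      ENNReal.toReal_ofReal (integral_nonneg_of_ae hG0), hGI]

end Rate

end SlidingRelay

theorem mainTheorem5
    {Ω : Type*} [MeasurableSpace Ω] (μ : Measure Ω) [IsProbabilityMeasure μ]
    (M L T : ℕ) [NeZero M] (hL : 2 ≤ L) (hT : T = L - 2 + 1)
    (P σ σ₁ σa2 : ℝ) (hP : 0 < P) (hσ : 0 < σ) (hσ₁ : 0 < σ₁) (hσa2 : σa2 = P * σ₁ ^ 2 / σ ^ 2)
    (h : SlidingRelay.WindowChannels Ω M)
    (hh : SlidingRelay.IsIndependentWindowModel μ T (σ₁ ^ 2) h)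
    (r : ℕ → Ω → Fin M) (hr : SlidingRelay.IsSlidingSelection T P (σ ^ 2) h r) :
    -- the CDF of the end-to-end SNR
    ((∀ x : ℝ, x < 0 → μ.real {ω | SlidingRelay.endToEndSNR T P (σ ^ 2) h r ω ≤ x} = 0) ∧
      (∀ x : ℝ, 0 ≤ x → μ.real {ω | SlidingRelay.endToEndSNR T P (σ ^ 2) h r ω ≤ x} =
        1 - (1 - (1 - Real.exp (-2 * x / σa2)) ^ M) *
          SlidingRelay.windowTail M σa2 x ^ (T - 1))) ∧
    -- the coefficients exist, with `M² (M² - 1)` terms, and depend on `M` only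
    (2 ≤ M → ∃ a b : Fin (M ^ 2 * (M ^ 2 - 1)) → ℝ, (∀ q, 0 < b q) ∧
      ∀ s : ℝ, 0 < s → ∀ x : ℝ, 0 ≤ x →
        ∑ q, a q * Real.exp (-b q * x / s) = SlidingRelay.windowTail M s x) ∧
    -- the achievable rate, for all coefficients that solve the identity
    (∀ (Q : ℕ) (a b : Fin Q → ℝ), (∀ q, 0 ≤ b q) →
      (∀ x : ℝ, 0 ≤ x →
        ∑ q, a q * Real.exp (-b q * x / σa2) = SlidingRelay.windowTail M σa2 x) →
      Integrable (fun ω => Real.logb 2 (1 + SlidingRelay.endToEndSNR T P (σ ^ 2) h r ω)) μ ∧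
      ∫ ω, Real.logb 2 (1 + SlidingRelay.endToEndSNR T P (σ ^ 2) h r ω) ∂μ =
        1 / Real.log 2 * ∑ i ∈ Finset.Icc 1 M,
          ∑ l ∈ Finset.piAntidiag (Finset.univ : Finset (Fin Q)) (T - 1),
            SlidingRelay.coeffA M a i l *
              Real.exp (SlidingRelay.coeffBeta b i l / σa2) *
              SlidingRelay.Ei (-(SlidingRelay.coeffBeta b i l / σa2))) := by
  subst hT
  have hn : 0 < σ ^ 2 := by positivity
  have hv : 0 < σ₁ ^ 2 := by positivity
  rw [Nat.add_sub_cancel]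
  refine ⟨⟨fun x hx => SlidingRelay.cdf_endToEndSNR_of_neg hP hn hx, fun x hx =>
    SlidingRelay.cdf_endToEndSNR hP hn hv hσa2 hh hr hx⟩,
    SlidingRelay.exists_exponential_sum_windowTail, fun Q a b hb hab => ?_⟩
  obtain ⟨h1, h2⟩ := SlidingRelay.integrable_and_integral_log hP hn hv hσa2 hh hr a b hb hab
  refine ⟨h1.div_const (Real.log 2), ?_⟩
  rw [← h2, one_div, inv_mul_eq_div, ← integral_div]
  rfl
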